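/- **Setting.** Let $\mathcal L_0$ be the language of $ID_1$: arithmetic ($0$, $S$, $=$ and further function and relation symbols with a standard interpretation on $\mathbb N$) plus a predicate $I$. For each quantifier-free *simple* formula $\phi(x,\vec y)$ (one containing no closed terms) add a Skolem function $c_{\exists x\phi}(\vec y)$; iterating gives $\mathcal L_0\subseteq\mathcal L_1\subseteq\cdots$, and $\mathcal L_\epsilon$ is the quantifier-free part of the union. The simple rank $rk_s$ of an expression is the least $n$ such that it lies in $\mathcal L_n$. Write $\exists x\,\phi(x,\vec t)$ for $\phi(c_{\exists x\phi}(\vec t),\vec t)$ and $\forall x\,\phi(x,\vec t)$ for $\phi(c_{\exists x\neg\phi}(\vec t),\vec t)$. Fix $A(x,X)=\forall z\,B(z,x,X)$, with $B$ simple, quantifier-free, without Skolem functions and with $X$ occurring only positively. The critical formulas are $\neg s=0\to\exists x\,s=Sx$ (Pred), $\phi(t)\to\exists x\,\phi(x)$ (Epsilon), $\phi(0)\wedge\neg\phi(t)\to\exists x(\phi(x)\wedge\neg\phi(Sx))$ (Induction), $A(t,I)\to t\in I$ (Inductive Definition) and $\forall x(A(x,\phi)\to\phi(x))\to\forall x(x\in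 I\to\phi(x))$ (Closure). Let $\mathrm{Cr}=\{Cr_0,\dots,Cr_N\}$ be a finite list of closed critical formulas. *Ranks and substitutions.* Canonical expressions are terms $c(\vec n)$ with $c$ a Skolem function and $\vec n$ numerals, and formulas $n\in I$; put $c_n=c_{\exists z\neg B(z,x,I)}(n)$. Ranks: $rk(n\in I)=rk(c_n)=\Omega$; for every other canonical term $e=c_{\exists x\phi}(\vec n)$, $rk(e)=rk_s(e)$ if $I$ does not occur in $\phi$ (not even inside Skolem function symbols), and $rk(e)=\Omega+rk_s(e)+1$ if it does. An $\epsilon$-substitution $S$ is a partial function giving canonical terms values that are $?$ or a positive numeral, and formulas $n\in I$ the value $?$ or $\top$. $|\cdot|_S$ denotes evaluation by $S$ ($?$ being read as $0$, respectively $\bot$), $S\vDash\phi$ means that $|\phi|_S$ is a true arithmetical sentence, $S$ decides $\phi$ if $S\vDash\phi$ or $S\vDash\neg\phi$, and $\overline S$ extends $S$ by $?$ elsewhere. $F(e,?)=\top$, $F(c_{\exists x\phi}(\vec n),u)=\phi(u,\vec n)\wedge\bigwedge_{v<u}\neg\phi(v,\vec n)$, $F(n\in I,\top)=A(n,I)$.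 $S$ is correct if $\overline S\vDash F(e,u)$ for all $(e,u)\in S$, and solving if $\overline S\vDash Cr_i$ for all $i\le N$. $S$ is computationally inconsistent if $S\vDash\neg F(e,u)$ for some $(e,u)\in S$, or if $(c_n,u),(n\in I,\top)\in S$ for some $n$ and some $u\ne{?}$. *Sequents.* $S^-_{=\Omega}$ is the set of pairs $(c_m,u)$ with $u\neq{?}$ and $(m\in I,?)$ in $S$; $S^+_{=\Omega}$ is the set of pairs $(c_m,?)$ and $(m\in I,\top)$ in $S$. A history $(P,V)$ is a finite sequence $P$ of distinct formulas $n\in I$ and a function $V$ on its entries whose values are finite $\epsilon$-substitutions $T$ with $T^-_{=\Omega}=T$. A sequent $\Theta=(S,P,V,F)$ consists of an $\epsilon$-substitution $S$, a history $(P,V)$ such that $P$ enumerates $\{n\in I\mid (n\in I,\top)\in S\}$, and labels $F(e)\in\{t,f\}$ for exactly those $e\in\operatorname{dom}(S)$ with $S(e)={?}$ or $rk(e)=\Omega$. $\emptyset$ is the empty sequent. $P=\langle n_1\in I,\dots,n_k\in I\rangle$ is admissible if, for each $i\le k$, $B(0,n_i,I)$ is true when $I$ is read as $\{n_j\mid j<i\}$.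 *The $H$-step.* Let $S$ be correct and nonsolving. To each $Cr_i$ with $\overline S\not\vDash Cr_i$ assign $(e_i,v_i)$, where $|\cdot|=|\cdot|_{\overline S}$ and $\vec s$ are the closed parameters of the matrix: for Pred, $(c_{\exists x\,y=Sx}(|s|),|s|-1)$; for Epsilon, $(c_{\exists x\phi}(|\vec s|),|t|)$; for Induction, $(c_{\exists x(\phi(x)\wedge\neg\phi(Sx))}(|\vec s|),m)$ with $m<|t|$ least such that $\overline S\vDash\phi(m)$ and $\overline S\vDash\neg\phi(m+1)$; for Inductive Definition, $(|t|\in I,\top)$; for Closure, with $n\in I$ the first entry of $P$ such that $\overline S\vDash\neg\phi(n)$, $(c_n,\overline S(c_{\exists z\neg B(z,x,\phi)}(n,|\vec s|)))$ if $\overline S\vDash\neg A(n,\phi)$, and $(c_{\exists x\neg(A(x,\phi)\to\phi(x))}(|\vec s|),n)$ otherwise. The $H$-expression $e$ and $H$-value $v$ are $(e_i,v_i)$ for the failing $i$ with $rk(e_i)$ least and then $i$ least. The substitution part of $H(S,P,V)$ is: $(S_{\le rk(e)}\setminus\{(e,?)\})\cup\{(e,v)\}$ if $rk(e)\ne\Omega$;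 $S_{<\Omega}\cup S^+_{=\Omega}\cup\{(e,\top)\}$ if $e$ is a formula; and, if $e=c_n$, $S_{<\Omega}\cup\{(c_m,?),(m\in I,\top)\in S\mid m\in I\text{ in }P'\}\cup V'\cup\{(c_n,v)\}$, where $P'$ is the longest initial segment of $P$ not containing $n\in I$ and $V'=V(n\in I)$ if $n\in I$ is in $P$, $V'=S^-_{=\Omega}$ otherwise. The $H$-step applies if all these calculations take place in $S$ rather than only in $\overline S$: $S$ decides every $Cr_i$; for every failing $Cr_i$, all terms $s,t,\vec s$ above evaluate to numerals in $S$, and $S$ decides $\phi(m)$ for all $m\le|t|$ (Induction), respectively decides $\phi(m)$ for all $m\in I$ in $P$ up to and including $n\in I$, decides $A(n,\phi)$, and in the first case contains the term whose value is $v_i$ in its domain (Closure); $(e,?)\in S$; if $e=c_n$ then $n\in I\in\operatorname{dom}(S)$; if $e$ is $n\in I$ then $c_n\in\operatorname{dom}(S)$; and if $e$ is a term of rank $\Omega$ then $m\in I\in\operatorname{dom}(S)$ whenever $(c_m,?)\in S$. An expression $e'\in\operatorname{dom}(S)$ is active if $rk(e')=rk(e)$ and $e'$ is missing from $H(S,P,V)$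 or has a different value there. *Axioms and $Cut$ rules.* $\Theta$ is an axiom if $S$ is computationally inconsistent ($AxF$), or $S$ is solving ($AxS$), or the $H$-step applies and some active $e'$ has $F(e')=f$ ($AxH$). The $Cut$ rules infer $\Theta$ from the following premises, where $e\notin\operatorname{dom}(S)$. - For a canonical term $e$ of rank $\neq\Omega$: $\Theta$ extended by $(e,?)$ with label $f$, and, for every $u\ge 1$, $\Theta$ extended by $(e,u)$. - For a canonical term $e$ of rank $\Omega$: the same premises, all with label $f$. - For $e$ a formula $n\in I$: $\Theta$ extended by $(e,?)$ with label $f$, and, for every history $(P_e,V_e)$ such that $P_e$ ends in $e$, has no entries in $\operatorname{dom}(S)$, has no entry $m\in I$ with $(c_m,u)\in S$ for some $u\neq{?}$, and is such that $P{}^\frown P_e$ is admissible, $\Theta$ extended by $(m\in I,\top)$ with label $f$ for all $m\in I$ in $P_e$, with $P$ extended to $P{}^\frown P_e$ and $V$ to $V\cup V_e$. In each case $e$ is the main expression of the inference, and its rank is $rk(e)$. A derivation is a well-founded tree of sequents all of whose leaves are axioms. Finally let $\rho(\emptyset,\mathrm{Cr})=\max_{i\le N} rk_s(|Cr_i|_\emptyset)$.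 **Theorem.** There is a derivation of the empty sequent $\emptyset$ all of whose inferences are $Cut$-inferences of rank $\le\Omega+\rho(\emptyset,\mathrm{Cr})+1$. -/

import Mathlib

open scoped Ordinal

noncomputable section

namespace EpsID1

/-! The quantifier-free Skolemized language of `ID₁`.

The arithmetical part consists of `0`, `S`, `=` and the further function and relation symbols of
an arbitrary first-order language `L` (for instance `+`, `·`, `<`), read in the standard model `ℕ`
by an `L`-structure on `ℕ`. -/

mutual
/-- Terms with free variables among `var 0, …, var (n - 1)`. `skol φ ts` is the term
`c_{∃ x φ(x, y₀, …, y_{k-1})}(ts)`, where `x` is variable `0` of `φ` and `yᵢ` is variable `i + 1`.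
The formula `φ` belongs to the name of the function symbol. -/
inductive Term (L : FirstOrder.Language.{0, 0}) : ℕ → Type
  | var {n : ℕ} (i : Fin n) : Term L n
  | zero {n : ℕ} : Term L n
  | succ {n : ℕ} (t : Term L n) : Term L n
  | func {n k : ℕ} (f : L.Functions k) (ts : Fin k → Term L n) : Term L n
  | skol {n k : ℕ} (φ : Formula L (k + 1)) (ts : Fin k → Term L n) : Term L n
/-- Quantifier-free formulas. `mem t` is the atomic formula `t ∈ I`. -/
inductive Formula (L : FirstOrder.Language.{0, 0}) : ℕ → Type
  | top {n : ℕ} : Formula L n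
  | bot {n : ℕ} : Formula L n
  | eq {n : ℕ} (s t : Term L n) : Formula L n
  | rel {n k : ℕ} (R : L.Relations k) (ts : Fin k → Term L n) : Formula L n
  | mem {n : ℕ} (t : Term L n) : Formula L n
  | neg {n : ℕ} (φ : Formula L n) : Formula L n
  | and {n : ℕ} (φ ψ : Formula L n) : Formula L n
  | or {n : ℕ} (φ ψ : Formula L n) : Formula L n
end

variable {L : FirstOrder.Language.{0, 0}}

def Formula.imp {n : ℕ} (φ ψ : Formula L n) : Formula L n := .or (.neg φ) ψ

/-- The numeral `S … S 0`. -/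
def numeral {n : ℕ} : ℕ → Term L n
  | 0 => .zero
  | m + 1 => .succ (numeral m)

/-- The number denoted by a term, if the term is a numeral. -/
def Term.num? {n : ℕ} : Term L n → Option ℕ
  | .zero => some 0
  | .succ t => t.num?.map Nat.succ
  | .var _ => none
  | .func _ _ => none
  | .skol _ _ => none

/-- The numbers denoted by a tuple of terms, if all of them are numerals. -/
def nums? {n k : ℕ} (ts : Fin k → Term L n) : Option (Fin k → ℕ) :=
  if ∀ i, (ts i).num?.isSome then some (fun i => (ts i).num?.getD 0) else none

/-- Simultaneous substitution. -/
def Term.subst {n m : ℕ} (σ : Fin n → Term L m) : Term L n → Term L m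
  | .var i => σ i
  | .zero => .zero
  | .succ t => .succ (t.subst σ)
  | .func f ts => .func f (fun i => (ts i).subst σ)
  | .skol φ ts => .skol φ (fun i => (ts i).subst σ)

def Formula.subst {n m : ℕ} (σ : Fin n → Term L m) : Formula L n → Formula L m
  | .top => .top
  | .bot => .bot
  | .eq s t => .eq (s.subst σ) (t.subst σ)
  | .rel R ts => .rel R (fun i => (ts i).subst σ)
  | .mem t => .mem (t.subst σ)
  | .neg φ => .neg (φ.subst σ)
  | .and φ ψ => .and (φ.subst σ) (ψ.subst σ)
  | .or φ ψ => .or (φ.subst σ) (ψ.subst σ)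

/-- Replacement of every atomic formula `t ∈ I` of `ψ` by `χ t`. -/
def Formula.plug {n : ℕ} (χ : Term L n → Formula L n) : Formula L n → Formula L n
  | .top => .top
  | .bot => .bot
  | .eq s t => .eq s t
  | .rel R ts => .rel R ts
  | .mem t => χ t
  | .neg φ => .neg (φ.plug χ)
  | .and φ ψ => .and (φ.plug χ) (ψ.plug χ)
  | .or φ ψ => .or (φ.plug χ) (ψ.plug χ)

/-- The term has no variables. -/
def Term.Closed {n : ℕ} : Term L n → Prop
  | .var _ => False
  | .zero => True
  | .succ t => t.Closed
  | .func _ ts => ∀ i, (ts i).Closed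
  | .skol _ ts => ∀ i, (ts i).Closed

/-- No subterm (the term itself included) is closed. -/
def Term.Simple {n : ℕ} : Term L n → Prop
  | .var _ => True
  | .zero => False
  | .succ t => t.Simple
  | .func f ts => ¬ (Term.func f ts).Closed ∧ ∀ i, (ts i).Simple
  | .skol φ ts => ¬ (Term.skol φ ts).Closed ∧ ∀ i, (ts i).Simple

/-- The formula is simple: it contains no closed terms. -/
def Formula.Simple {n : ℕ} : Formula L n → Prop
  | .top => True
  | .bot => True
  | .eq s t => s.Simple ∧ t.Simple
  | .rel _ ts => ∀ i, (ts i).Simple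
  | .mem t => t.Simple
  | .neg φ => φ.Simple
  | .and φ ψ => φ.Simple ∧ ψ.Simple
  | .or φ ψ => φ.Simple ∧ ψ.Simple

mutual
/-- The term belongs to `𝓛_ε`: Skolem functions are introduced for simple formulas only. -/
def Term.WF {n : ℕ} : Term L n → Prop
  | .var _ => True
  | .zero => True
  | .succ t => t.WF
  | .func _ ts => ∀ i, (ts i).WF
  | .skol φ ts => (φ.Simple ∧ φ.WF) ∧ ∀ i, (ts i).WF
/-- The formula belongs to `𝓛_ε`. -/
def Formula.WF {n : ℕ} : Formula L n → Prop
  | .top => True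
  | .bot => True
  | .eq s t => s.WF ∧ t.WF
  | .rel _ ts => ∀ i, (ts i).WF
  | .mem t => t.WF
  | .neg φ => φ.WF
  | .and φ ψ => φ.WF ∧ ψ.WF
  | .or φ ψ => φ.WF ∧ ψ.WF
end

mutual
/-- The simple rank: the least `n` with the term in `𝓛ₙ`, where `𝓛₀` has no Skolem functions and
`𝓛ₙ₊₁` adds a Skolem function for every simple formula of `𝓛ₙ`. -/
def Term.rkS {n : ℕ} : Term L n → ℕ
  | .var _ => 0
  | .zero => 0
  | .succ t => t.rkS
  | .func _ ts => Finset.univ.sup fun i => (ts i).rkS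
  | .skol φ ts => max (φ.rkS + 1) (Finset.univ.sup fun i => (ts i).rkS)
/-- The simple rank of a formula. -/
def Formula.rkS {n : ℕ} : Formula L n → ℕ
  | .top => 0
  | .bot => 0
  | .eq s t => max s.rkS t.rkS
  | .rel _ ts => Finset.univ.sup fun i => (ts i).rkS
  | .mem t => t.rkS
  | .neg φ => φ.rkS
  | .and φ ψ => max φ.rkS ψ.rkS
  | .or φ ψ => max φ.rkS ψ.rkS
end

mutual
/-- `I` occurs in the term, possibly in the name of a Skolem function. -/
def Term.HasI {n : ℕ} : Term L n → Prop
  | .var _ => False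
  | .zero => False
  | .succ t => t.HasI
  | .func _ ts => ∃ i, (ts i).HasI
  | .skol φ ts => φ.HasI ∨ ∃ i, (ts i).HasI
/-- `I` occurs in the formula, possibly in the name of a Skolem function. -/
def Formula.HasI {n : ℕ} : Formula L n → Prop
  | .top => False
  | .bot => False
  | .eq s t => s.HasI ∨ t.HasI
  | .rel _ ts => ∃ i, (ts i).HasI
  | .mem _ => True
  | .neg φ => φ.HasI
  | .and φ ψ => φ.HasI ∨ ψ.HasI
  | .or φ ψ => φ.HasI ∨ ψ.HasI
end

/-- The term has no Skolem functions. -/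
def Term.NoSkol {n : ℕ} : Term L n → Prop
  | .var _ => True
  | .zero => True
  | .succ t => t.NoSkol
  | .func _ ts => ∀ i, (ts i).NoSkol
  | .skol _ _ => False

/-- The formula has no Skolem functions, i.e. is a quantifier-free formula of `𝓛₀`. -/
def Formula.NoSkol {n : ℕ} : Formula L n → Prop
  | .top => True
  | .bot => True
  | .eq s t => s.NoSkol ∧ t.NoSkol
  | .rel _ ts => ∀ i, (ts i).NoSkol
  | .mem t => t.NoSkol
  | .neg φ => φ.NoSkol
  | .and φ ψ => φ.NoSkol ∧ ψ.NoSkol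
  | .or φ ψ => φ.NoSkol ∧ ψ.NoSkol

/-- The formula is in the language of arithmetic: no Skolem functions and no `I`. -/
def Formula.IsArith {n : ℕ} (φ : Formula L n) : Prop := φ.NoSkol ∧ ¬ φ.HasI

/-- With `b = true`: all occurrences of `I` are positive; with `b = false`: all are negative. -/
def Formula.Polar {n : ℕ} (b : Bool) : Formula L n → Prop
  | .top => True
  | .bot => True
  | .eq _ _ => True
  | .rel _ _ => True
  | .mem _ => b = true
  | .neg φ => φ.Polar (!b)
  | .and φ ψ => φ.Polar b ∧ ψ.Polar b
  | .or φ ψ => φ.Polar b ∧ ψ.Polar b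

/-- Standard value of an arithmetical term (Skolem terms get a dummy value). -/
def Term.val [L.Structure ℕ] {n : ℕ} (x : Fin n → ℕ) : Term L n → ℕ
  | .var i => x i
  | .zero => 0
  | .succ t => t.val x + 1
  | .func f ts => FirstOrder.Language.Structure.funMap f (fun i => (ts i).val x)
  | .skol _ _ => 0

/-- Truth of an arithmetical formula in the standard model; only used under `IsArith`. -/
def Formula.Realize [L.Structure ℕ] {n : ℕ} (x : Fin n → ℕ) : Formula L n → Prop
  | .top => True
  | .bot => False
  | .eq s t => s.val x = t.val x
  | .rel R ts => FirstOrder.Language.Structure.RelMap R (fun i => (ts i).val x)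
  | .mem _ => False
  | .neg φ => ¬ φ.Realize x
  | .and φ ψ => φ.Realize x ∧ ψ.Realize x
  | .or φ ψ => φ.Realize x ∨ ψ.Realize x

/-- Truth of an arithmetical sentence. -/
def Formula.Holds [L.Structure ℕ] (φ : Formula L 0) : Prop := φ.Realize Fin.elim0

/-! Quantifiers as abbreviations, for a matrix `φ(x, y⃗)` and a tuple `s⃗`. -/

/-- `∃ x φ(x, s⃗)`, i.e. `φ(c_{∃ x φ}(s⃗), s⃗)`. -/
def exF {n k : ℕ} (φ : Formula L (k + 1)) (s : Fin k → Term L n) : Formula L n :=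
  φ.subst (Fin.cons (.skol φ s) s)

/-- `∀ x φ(x, s⃗)`, i.e. `φ(c_{∃ x ¬φ}(s⃗), s⃗)`. -/
def allF {n k : ℕ} (φ : Formula L (k + 1)) (s : Fin k → Term L n) : Formula L n :=
  φ.subst (Fin.cons (.skol φ.neg s) s)

/-- The matrix `B(z, x, X)` of the inductive definition `A(x, X) = ∀ z B(z, x, X)`. The variable
`z` is `var 0`, `x` is `var 1`, and the atoms `mem t` stand for `t ∈ X`. -/
structure PosOp (L : FirstOrder.Language.{0, 0}) where
  B : Formula L 2
  noSkol : B.NoSkol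
  simple : B.Simple
  pos : B.Polar true

/-- `A(t, I)`. -/
def PosOp.A {n : ℕ} (D : PosOp L) (t : Term L n) : Formula L n := allF D.B (fun _ : Fin 1 => t)

/-- `B(z, x, φ)` for `φ = φ(·, y⃗)`, as a formula in `z, x, y⃗`. -/
def PosOp.Bφ {k : ℕ} (D : PosOp L) (φ : Formula L (k + 1)) : Formula L (k + 2) :=
  (D.B.subst (fun i : Fin 2 => Term.var (Fin.castLE (by omega) i))).plug
    (fun t => φ.subst (Fin.cons t (fun i => Term.var i.succ.succ)))

/-- `A(t, φ)` for `φ = φ(·, s⃗)`. -/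
def PosOp.Aφ {n k : ℕ} (D : PosOp L) (φ : Formula L (k + 1)) (s : Fin k → Term L n)
    (t : Term L n) : Formula L n :=
  allF (D.Bφ φ) (Fin.cons t s)

/-- `A(x, φ) → φ(x)`, as a formula in `x, y⃗`. -/
def PosOp.prog {k : ℕ} (D : PosOp L) (φ : Formula L (k + 1)) : Formula L (k + 1) :=
  (D.Aφ φ (fun i => .var i.succ) (.var 0)).imp φ

/-- `φ(x) ∧ ¬φ(S x)`, as a formula in `x, y⃗`. -/
def indStep {k : ℕ} (φ : Formula L (k + 1)) : Formula L (k + 1) :=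
  φ.and (φ.subst (Fin.cons (.succ (.var 0)) (fun i => .var i.succ))).neg

/-- `y = S x`, as a formula in `x, y`. -/
def predMatrix : Formula L 2 := .eq (.var 1) (.succ (.var 0))

/-- Closed critical formulas. The matrices `φ(x, y⃗)` are simple; `s⃗` is the tuple of closed terms
substituted for `y⃗`. -/
inductive Critical (L : FirstOrder.Language.{0, 0}) : Type
  | pred (s : Term L 0) : Critical L
  | eps {k : ℕ} (φ : Formula L (k + 1)) (s : Fin k → Term L 0) (t : Term L 0) : Critical L
  | ind {k : ℕ} (φ : Formula L (k + 1)) (s : Fin k → Term L 0) (t : Term L 0) : Critical L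
  | inddef (t : Term L 0) : Critical L
  | closure {k : ℕ} (φ : Formula L (k + 1)) (s : Fin k → Term L 0) : Critical L

/-- All ingredients belong to `𝓛_ε`, and the matrix is simple. -/
def Critical.WF : Critical L → Prop
  | .pred s => s.WF
  | .eps φ s t => (φ.Simple ∧ φ.WF) ∧ (∀ i, (s i).WF) ∧ t.WF
  | .ind φ s t => (φ.Simple ∧ φ.WF) ∧ (∀ i, (s i).WF) ∧ t.WF
  | .inddef t => t.WF
  | .closure φ s => (φ.Simple ∧ φ.WF) ∧ ∀ i, (s i).WF

/-- `φ(t, s⃗)`. -/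
def inst {n k : ℕ} (φ : Formula L (k + 1)) (s : Fin k → Term L n) (t : Term L n) : Formula L n :=
  φ.subst (Fin.cons t s)

/-- The critical formula itself. -/
def Critical.toFormula (D : PosOp L) : Critical L → Formula L 0
  | .pred s => (Formula.eq s .zero).neg.imp (exF predMatrix (fun _ : Fin 1 => s))
  | .eps φ s t => (inst φ s t).imp (exF φ s)
  | .ind φ s t => ((inst φ s .zero).and (inst φ s t).neg).imp (exF (indStep φ) s)
  | .inddef t => (D.A t).imp (.mem t)
  | .closure φ s => (allF (D.prog φ) s).imp (allF ((Formula.mem (.var 0)).imp φ) s)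

/-! Canonical expressions, ranks, substitutions. -/

/-- `term φ v` is `c_{∃ x φ}(v)` with numerals `v`; `form n` is the formula `n ∈ I`. -/
inductive CanExpr (L : FirstOrder.Language.{0, 0}) : Type
  | term {k : ℕ} (φ : Formula L (k + 1)) (v : Fin k → ℕ) : CanExpr L
  | form (n : ℕ) : CanExpr L

/-- The Skolem function is one of `𝓛_ε`. -/
def CanExpr.IsCanonical : CanExpr L → Prop
  | .term φ _ => φ.Simple ∧ φ.WF
  | .form _ => True

def CanExpr.IsTerm : CanExpr L → Prop
  | .term _ _ => True
  | .form _ => False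

/-- `c_n`, the term `c_{∃ z ¬B(z, x, I)}(n)`. -/
def PosOp.c (D : PosOp L) (n : ℕ) : CanExpr L := .term D.B.neg (fun _ : Fin 1 => n)

/-- The ordinal `Ω`; all other ranks are of the form `m` or `Ω + m` with `m` finite. -/
def Om : Ordinal.{0} := ω₁

open Classical in
/-- The rank of a canonical expression. -/
def PosOp.rk (D : PosOp L) : CanExpr L → Ordinal.{0}
  | .form _ => Om
  | .term φ v =>
      if ∃ n, CanExpr.term φ v = D.c n then Om
      else if φ.HasI then Om + ((φ.rkS + 1 : ℕ) : Ordinal.{0}) + 1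
      else ((φ.rkS + 1 : ℕ) : Ordinal.{0})

/-- The symbol `?`, numerals, and `⊤`. -/
inductive Val : Type
  | unk : Val
  | num (n : ℕ) : Val
  | tt : Val

/-- Terms get `?` or a positive numeral, formulas get `?` or `⊤`. -/
def CanExpr.Fits : CanExpr L → Val → Prop
  | .term _ _, .unk => True
  | .term _ _, .num n => 0 < n
  | .term _ _, .tt => False
  | .form _, .unk => True
  | .form _, .num _ => False
  | .form _, .tt => True

/-- Partial functions from canonical expressions to values. -/
abbrev Sub (L : FirstOrder.Language.{0, 0}) : Type := CanExpr L → Option Val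

/-- `S` is an `ε`-substitution. -/
def Sub.IsSub (S : Sub L) : Prop := ∀ e u, S e = some u → e.IsCanonical ∧ e.Fits u

def Sub.dom (S : Sub L) : Set (CanExpr L) := {e | (S e).isSome}

/-- The set of pairs `(e, u) ∈ S`. -/
def Sub.graph (S : Sub L) : Set (CanExpr L × Val) := {p | S p.1 = some p.2}

open Classical in
/-- The standard extension of `S`: every other canonical expression gets `?`. -/
def Sub.bar (S : Sub L) : Sub L := fun e =>
  match S e with
  | some u => some u
  | none => if e.IsCanonical then some .unk else none

/-- The reduction `|t|_S`. -/
def Term.red [L.Structure ℕ] {n : ℕ} (S : Sub L) : Term L n → Term L n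
  | .var i => .var i
  | .zero => .zero
  | .succ t => .succ (t.red S)
  | .func f ts =>
      match nums? (fun i => (ts i).red S) with
      | some v => numeral (FirstOrder.Language.Structure.funMap f v)
      | none => .func f (fun i => (ts i).red S)
  | .skol φ ts =>
      match nums? (fun i => (ts i).red S) with
      | some v =>
          match S (.term φ v) with
          | some (.num m) => numeral m
          | some _ => .zero
          | none => .skol φ (fun i => (ts i).red S)
      | none => .skol φ (fun i => (ts i).red S)

/-- The reduction `|φ|_S`. -/
def Formula.red [L.Structure ℕ] {n : ℕ} (S : Sub L) : Formula L n → Formula L n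
  | .top => .top
  | .bot => .bot
  | .eq s t => .eq (s.red S) (t.red S)
  | .rel R ts => .rel R (fun i => (ts i).red S)
  | .mem t =>
      match (t.red S).num? with
      | some m =>
          match S (.form m) with
          | some .tt => .top
          | some _ => .bot
          | none => .mem (t.red S)
      | none => .mem (t.red S)
  | .neg φ => .neg (φ.red S)
  | .and φ ψ => .and (φ.red S) (ψ.red S)
  | .or φ ψ => .or (φ.red S) (ψ.red S)

section Semantics

variable [L.Structure ℕ]

/-- `S ⊨ φ`. -/
def Sub.Sat (S : Sub L) (φ : Formula L 0) : Prop := (φ.red S).IsArith ∧ (φ.red S).Holds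

/-- `S` decides `φ`. -/
def Sub.Decides (S : Sub L) (φ : Formula L 0) : Prop := S.Sat φ ∨ S.Sat φ.neg

/-- `⋀_{v < u} ¬φ(v)`. -/
def conjNeg (φ : ℕ → Formula L 0) : ℕ → Formula L 0
  | 0 => .top
  | u + 1 => .and (conjNeg φ u) (φ u).neg

/-- `φ(u, v⃗)` for numerals. -/
def instNum {k : ℕ} (φ : Formula L (k + 1)) (v : Fin k → ℕ) (u : ℕ) : Formula L 0 :=
  inst φ (fun i => numeral (v i)) (numeral u)

/-- The formula `F(e, u)`. -/
def PosOp.F (D : PosOp L) : CanExpr L → Val → Formula L 0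
  | .term φ v, .num u => (instNum φ v u).and (conjNeg (instNum φ v) u)
  | .form n, .tt => D.A (numeral n)
  | _, _ => .top

/-- `S` is correct. -/
def PosOp.Correct (D : PosOp L) (S : Sub L) : Prop := ∀ e u, S e = some u → S.bar.Sat (D.F e u)

/-- `S` is computationally inconsistent. -/
def PosOp.CI (D : PosOp L) (S : Sub L) : Prop :=
  (∃ e u, S e = some u ∧ S.Sat (D.F e u).neg) ∨
    ∃ n u, S (D.c n) = some u ∧ u ≠ .unk ∧ S (.form n) = some .tt

/-- `S` is solving. -/
def PosOp.Solving (D : PosOp L) {N : ℕ} (Cr : Fin (N + 1) → Critical L) (S : Sub L) : Prop :=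
  ∀ i, S.bar.Sat ((Cr i).toFormula D)

/-! Histories. The formula `n ∈ I` is represented by the number `n` in the sequence `P` and in the
domain of `V`. -/

/-- `(e, u)` belongs to the part `S⁻_{=Ω}` of every substitution `S` it is in. -/
def PosOp.NegPair (D : PosOp L) (e : CanExpr L) (u : Val) : Prop :=
  (∃ n, e = D.c n ∧ u ≠ .unk) ∨ (∃ n, e = .form n ∧ u = .unk)

/-- `(e, u)` belongs to the part `S⁺_{=Ω}` of every substitution `S` it is in. -/
def PosOp.PosPair (D : PosOp L) (e : CanExpr L) (u : Val) : Prop :=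
  (∃ n, e = D.c n ∧ u = .unk) ∨ (∃ n, e = .form n ∧ u = .tt)

open Classical in
/-- `S⁻_{=Ω}`. -/
def PosOp.negPart (D : PosOp L) (S : Sub L) : Sub L := fun e =>
  match S e with
  | some u => if D.NegPair e u then some u else none
  | none => none

/-- `P, V` is a substitution history. -/
def PosOp.IsHistory (D : PosOp L) (P : List ℕ) (V : ℕ → Option (Sub L)) : Prop :=
  P.Nodup ∧ (∀ n, (V n).isSome ↔ n ∈ P) ∧
    ∀ n T, V n = some T → T.IsSub ∧ T.dom.Finite ∧ D.negPart T = T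

open Classical in
/-- The substitution `{(m ∈ I, ⊤) | m in the list}`. -/
def topSub (l : List ℕ) : Sub L
  | .form m => if m ∈ l then some .tt else none
  | .term _ _ => none

/-- `P` is admissible. -/
def PosOp.Admissible (D : PosOp L) (P : List ℕ) : Prop :=
  ∀ l n l', P = l ++ n :: l' →
    (topSub l : Sub L).bar.Sat (D.B.subst ![numeral 0, numeral n])

/-! The `H`-step at a historical substitution `(S, P, V)`. -/

/-- The value of a closed term under the standard extension. -/
def Sub.ev (S : Sub L) (t : Term L 0) : ℕ := ((t.red S.bar).num?).getD 0

open Classical in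
/-- The first `n` in `P` with `¬φ(n, s⃗)` under the standard extension. -/
def firstFail {k : ℕ} (S : Sub L) (P : List ℕ) (φ : Formula L (k + 1)) (s : Fin k → Term L 0) :
    Option ℕ :=
  P.find? fun n => decide (S.bar.Sat (inst φ s (numeral n)).neg)

open Classical in
/-- The expression and the value which would repair a failing critical formula. -/
def PosOp.repair (D : PosOp L) (S : Sub L) (P : List ℕ) : Critical L → CanExpr L × Val
  | .pred s => (.term predMatrix (fun _ : Fin 1 => S.ev s), .num (S.ev s - 1))
  | .eps φ s t => (.term φ (fun i => S.ev (s i)), .num (S.ev t))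
  | .ind φ s t =>
      (.term (indStep φ) (fun i => S.ev (s i)),
        .num (sInf {m | m < S.ev t ∧ S.bar.Sat (inst φ s (numeral m)) ∧
          S.bar.Sat (inst φ s (numeral (m + 1))).neg}))
  | .inddef t => (.form (S.ev t), .tt)
  | .closure φ s =>
      let n := (firstFail S P φ s).getD 0
      if S.bar.Sat (D.Aφ φ s (numeral n)).neg then
        (D.c n, (S.bar (.term (D.Bφ φ).neg (Fin.cons n fun i => S.ev (s i)))).getD .unk)
      else (.term (D.prog φ).neg (fun i => S.ev (s i)), .num n)

/-- The closed term reduces to a numeral in `S` itself. -/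
def Sub.Computes (S : Sub L) (t : Term L 0) : Prop := (t.red S).num?.isSome

/-- The calculation of the expression and value repairing a failing critical formula takes place in
`S` itself. -/
def PosOp.RepairComputed (D : PosOp L) (S : Sub L) (P : List ℕ) : Critical L → Prop
  | .pred s => S.Computes s
  | .eps _ s t => (∀ i, S.Computes (s i)) ∧ S.Computes t
  | .ind φ s t => (∀ i, S.Computes (s i)) ∧ S.Computes t ∧
      ∀ m ≤ S.ev t, S.Decides (inst φ s (numeral m))
  | .inddef t => S.Computes t
  | .closure φ s => (∀ i, S.Computes (s i)) ∧
      ∃ l n l', P = l ++ n :: l' ∧ firstFail S P φ s = some n ∧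
        (∀ m ∈ l ++ [n], S.Decides (inst φ s (numeral m))) ∧
        S.Decides (D.Aφ φ s (numeral n)) ∧
        (S.Sat (D.Aφ φ s (numeral n)).neg →
          CanExpr.term (D.Bφ φ).neg (Fin.cons n fun i => S.ev (s i)) ∈ S.dom)

/-- `i` is the index chosen by the `H`-step: among the failing critical formulas the rank of the
repairing expression is least, and `i` is the least such index. -/
def PosOp.IsHIndex (D : PosOp L) {N : ℕ} (Cr : Fin (N + 1) → Critical L) (S : Sub L) (P : List ℕ)
    (i : Fin (N + 1)) : Prop :=
  ¬ S.bar.Sat ((Cr i).toFormula D) ∧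
    ∀ j, ¬ S.bar.Sat ((Cr j).toFormula D) →
      D.rk (D.repair S P (Cr i)).1 ≤ D.rk (D.repair S P (Cr j)).1 ∧
      (D.rk (D.repair S P (Cr j)).1 = D.rk (D.repair S P (Cr i)).1 → i ≤ j)

/-- The number `n` when `e` is `c_n` or `n ∈ I`. -/
def CanExpr.index : CanExpr L → ℕ
  | .form n => n
  | .term (k := k) _ v => if h : 0 < k then v ⟨0, h⟩ else 0

/-- Longest initial segment of `P` without `n`. -/
def before (P : List ℕ) (n : ℕ) : List ℕ := P.takeWhile (fun m => decide (m ≠ n))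

open Classical in
/-- The substitution component of `H(S, P, V)`, as a set of pairs, for `H`-expression `e` and
`H`-value `v`. -/
def PosOp.HS (D : PosOp L) (S : Sub L) (P : List ℕ) (V : ℕ → Option (Sub L)) (e : CanExpr L)
    (v : Val) : Set (CanExpr L × Val) :=
  if D.rk e ≠ Om then
    ({p ∈ S.graph | D.rk p.1 ≤ D.rk e} \ {(e, .unk)}) ∪ {(e, v)}
  else if e.IsTerm then
    {p ∈ S.graph | D.rk p.1 < Om} ∪
      ({p ∈ S.graph | ∃ m ∈ before P e.index, p = (D.c m, .unk)} ∪
        {p ∈ S.graph | ∃ m ∈ before P e.index, p = (.form m, .tt)}) ∪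
      (if e.index ∈ P then ((V e.index).getD fun _ => none).graph else (D.negPart S).graph) ∪
      {(e, v)}
  else
    {p ∈ S.graph | D.rk p.1 < Om} ∪ {p ∈ S.graph | D.PosPair p.1 p.2} ∪ {(e, .tt)}

open Classical in
/-- The sequence component of `H(S, P, V)`. -/
def PosOp.HP (D : PosOp L) (P : List ℕ) (e : CanExpr L) : List ℕ :=
  if D.rk e < Om then []
  else if Om < D.rk e then P
  else if e.IsTerm then before P e.index
  else P ++ [e.index]

open Classical in
/-- The history component of `H(S, P, V)`. -/
def PosOp.HV (D : PosOp L) (S : Sub L) (P : List ℕ) (V : ℕ → Option (Sub L)) (e : CanExpr L) :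
    ℕ → Option (Sub L) :=
  if D.rk e < Om then fun _ => none
  else if Om < D.rk e then V
  else if e.IsTerm then fun m => if m ∈ before P e.index then V m else none
  else Function.update V e.index (some (D.negPart S))

/-- The `H`-step applies to `(S, P, V)` with `H`-expression `e` and `H`-value `v`: `S` is correct
and nonsolving, and all calculations in the computation of `H(S, P, V)` take place in `S`. -/
def PosOp.HApplies (D : PosOp L) {N : ℕ} (Cr : Fin (N + 1) → Critical L) (S : Sub L) (P : List ℕ)
    (e : CanExpr L) (v : Val) : Prop :=
  D.Correct S ∧ ¬ D.Solving Cr S ∧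
  (∀ j, S.Decides ((Cr j).toFormula D)) ∧
  (∀ j, ¬ S.bar.Sat ((Cr j).toFormula D) → D.RepairComputed S P (Cr j)) ∧
  (∃ i, D.IsHIndex Cr S P i ∧ D.repair S P (Cr i) = (e, v)) ∧
  S e = some .unk ∧
  (∀ n, e = D.c n → .form n ∈ S.dom) ∧
  (∀ n, e = .form n → D.c n ∈ S.dom) ∧
  (e.IsTerm → D.rk e = Om → ∀ m, S (D.c m) = some .unk → .form m ∈ S.dom)

/-- `e'` is active at `(S, P, V)`, for `H`-expression `e` and `H`-value `v`. -/
def PosOp.Active (D : PosOp L) (S : Sub L) (P : List ℕ) (V : ℕ → Option (Sub L)) (e : CanExpr L)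
    (v : Val) (e' : CanExpr L) : Prop :=
  e' ∈ S.dom ∧ D.rk e' = D.rk e ∧
    ((∀ u, (e', u) ∉ D.HS S P V e v) ∨ ∃ u, (e', u) ∈ D.HS S P V e v ∧ S e' ≠ some u)

end Semantics

/-! Sequents and the deduction system. -/

/-- The data `(S, P, V, F)` of a sequent; the labels `t`, `f` are `true`, `false`. -/
structure Sequent (L : FirstOrder.Language.{0, 0}) : Type where
  S : Sub L
  P : List ℕ
  V : ℕ → Option (Sub L)
  F : CanExpr L → Option Bool

/-- The expressions that carry a label. -/
def PosOp.Labelled (D : PosOp L) (S : Sub L) (e : CanExpr L) : Prop :=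
  S e = some .unk ∨ (e ∈ S.dom ∧ D.rk e = Om)

/-- `(S, P, V)` is a historical substitution and `F` labels exactly the expressions of value `?` or
of rank `Ω`. -/
def PosOp.IsSequent (D : PosOp L) (Θ : Sequent L) : Prop :=
  Θ.S.IsSub ∧ D.IsHistory Θ.P Θ.V ∧ (∀ n, n ∈ Θ.P ↔ Θ.S (.form n) = some .tt) ∧
    ∀ e, (Θ.F e).isSome ↔ D.Labelled Θ.S e

/-- The empty sequent. -/
def Sequent.empty : Sequent L where
  S := fun _ => none
  P := []
  V := fun _ => none
  F := fun _ => none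

open Classical in
/-- `(e, u), Θ`. -/
def Sequent.add (Θ : Sequent L) (e : CanExpr L) (u : Val) : Sequent L where
  S := Function.update Θ.S e (some u)
  P := Θ.P
  V := Θ.V
  F := Θ.F

open Classical in
/-- `(e, u, i), Θ`. -/
def Sequent.addL (Θ : Sequent L) (e : CanExpr L) (u : Val) (i : Bool) : Sequent L where
  S := Function.update Θ.S e (some u)
  P := Θ.P
  V := Θ.V
  F := Function.update Θ.F e (some i)

open Classical in
/-- `(e, ⊤, i, P_e, V_e), Θ`. -/
def Sequent.addTop (Θ : Sequent L) (i : Bool) (Pe : List ℕ) (Ve : ℕ → Option (Sub L)) :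
    Sequent L where
  S := fun e => if ∃ m ∈ Pe, e = .form m then some .tt else Θ.S e
  P := Θ.P ++ Pe
  V := fun m => if m ∈ Pe then Ve m else Θ.V m
  F := fun e => if ∃ m ∈ Pe, e = .form m then some i else Θ.F e

section Deductions

variable [L.Structure ℕ]

/-- `P_e` is proper for `n ∈ I` and `Θ`. The formulas of `P_e` are not in the domain of `Θ`. -/
def PosOp.Proper (D : PosOp L) (n : ℕ) (Θ : Sequent L) (Pe : List ℕ) : Prop :=
  Pe.Nodup ∧ (∀ m ∈ Pe, ∀ u, Θ.S (D.c m) = some u → u = .unk) ∧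
    D.Admissible (Θ.P ++ Pe) ∧ Pe.getLast? = some n ∧
    (∀ m ∈ Pe, m ∉ Θ.P) ∧ ∀ m ∈ Pe, .form m ∉ Θ.S.dom

/-- `Ψ` is `H(Θ)`, for `H`-expression `e` and `H`-value `v`. -/
def PosOp.IsH (D : PosOp L) (Θ Ψ : Sequent L) (e : CanExpr L) (v : Val) : Prop :=
  Ψ.S.graph = D.HS Θ.S Θ.P Θ.V e v ∧ Ψ.P = D.HP Θ.P e ∧ Ψ.V = D.HV Θ.S Θ.P Θ.V e ∧
    ∀ e', (¬ D.Labelled Ψ.S e' → Ψ.F e' = none) ∧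
      (D.Labelled Ψ.S e' → e' ∈ Θ.S.dom → Ψ.F e' = Θ.F e') ∧
      (D.Labelled Ψ.S e' → e' ∉ Θ.S.dom → Ψ.F e' = some true)

/-- The axioms `AxF`, `AxS`, `AxH`. -/
def PosOp.IsAxiom (D : PosOp L) {N : ℕ} (Cr : Fin (N + 1) → Critical L) (Θ : Sequent L) : Prop :=
  D.CI Θ.S ∨ D.Solving Cr Θ.S ∨
    ∃ e v, D.HApplies Cr Θ.S Θ.P e v ∧
      ∃ e', D.Active Θ.S Θ.P Θ.V e v e' ∧ Θ.F e' = some false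

/-- Names of inference rules, with their main expression. -/
inductive Rule (L : FirstOrder.Language.{0, 0}) : Type
  | cut (e : CanExpr L) : Rule L
  | cutFr (e : CanExpr L) : Rule L
  | cutOmTerm (e : CanExpr L) : Rule L
  | cutFrOmTerm (e : CanExpr L) : Rule L
  | cutOmForm (n : ℕ) : Rule L
  | fr (e : CanExpr L) : Rule L
  | h (e : CanExpr L) (v : Val) : Rule L

/-- The side condition for the rule to be applied with conclusion `Θ`. -/
def PosOp.Applicable (D : PosOp L) {N : ℕ} (Cr : Fin (N + 1) → Critical L) (Θ : Sequent L) :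
    Rule L → Prop
  | .cut e => e.IsCanonical ∧ e.IsTerm ∧ D.rk e ≠ Om ∧ e ∉ Θ.S.dom
  | .cutFr e => e.IsCanonical ∧ e.IsTerm ∧ D.rk e ≠ Om ∧ e ∉ Θ.S.dom
  | .cutOmTerm e => e.IsCanonical ∧ e.IsTerm ∧ D.rk e = Om ∧ e ∉ Θ.S.dom
  | .cutFrOmTerm e => e.IsCanonical ∧ e.IsTerm ∧ D.rk e = Om ∧ e ∉ Θ.S.dom
  | .cutOmForm n => .form n ∉ Θ.S.dom
  | .fr e => e.IsCanonical ∧ e ∉ Θ.S.dom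
  | .h e v => D.HApplies Cr Θ.S Θ.P e v ∧ Θ.F e = some true ∧
      (∀ e', D.Active Θ.S Θ.P Θ.V e v e' → Θ.F e' = some true) ∧
      ∃ Ψ, D.IsH Θ Ψ e v

/-- `Ψ` is one of the premises of the rule with conclusion `Θ`. -/
def PosOp.IsPremise (D : PosOp L) (Θ Ψ : Sequent L) : Rule L → Prop
  | .cut e => Ψ = Θ.addL e .unk false ∨ ∃ u, 0 < u ∧ Ψ = Θ.add e (.num u)
  | .cutFr e => Ψ = Θ.addL e .unk true ∨ ∃ u, 0 < u ∧ Ψ = Θ.add e (.num u)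
  | .cutOmTerm e => Ψ = Θ.addL e .unk false ∨ ∃ u, 0 < u ∧ Ψ = Θ.addL e (.num u) false
  | .cutFrOmTerm e => Ψ = Θ.addL e .unk true ∨ ∃ u, 0 < u ∧ Ψ = Θ.addL e (.num u) false
  | .cutOmForm n => Ψ = Θ.addL (.form n) .unk false ∨
      ∃ Pe Ve, D.Proper n Θ Pe ∧ D.IsHistory Pe Ve ∧ Ψ = Θ.addTop false Pe Ve
  | .fr e => Ψ = Θ.addL e .unk true
  | .h e v => D.IsH Θ Ψ e v

/-- Deductions of `Θ` from the set `T` of sequents: well-founded trees of sequents. -/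
inductive Deduction (D : PosOp L) {N : ℕ} (Cr : Fin (N + 1) → Critical L) (T : Set (Sequent L)) :
    Sequent L → Type
  | hyp (Θ : Sequent L) (hs : D.IsSequent Θ) (h : Θ ∈ T) : Deduction D Cr T Θ
  | ax (Θ : Sequent L) (hs : D.IsSequent Θ) (h : D.IsAxiom Cr Θ) : Deduction D Cr T Θ
  | inf (Θ : Sequent L) (hs : D.IsSequent Θ) (R : Rule L) (h : D.Applicable Cr Θ R)
      (d : ∀ Ψ, D.IsPremise Θ Ψ R → Deduction D Cr T Ψ) : Deduction D Cr T Θ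

/-- Every inference in the deduction has the property `p`. -/
def Deduction.AllRules {D : PosOp L} {N : ℕ} {Cr : Fin (N + 1) → Critical L}
    {T : Set (Sequent L)} (p : Rule L → Prop) : {Θ : Sequent L} → Deduction D Cr T Θ → Prop
  | _, .hyp _ _ _ => True
  | _, .ax _ _ _ => True
  | _, .inf _ _ R _ d => p R ∧ ∀ Ψ hΨ, (d Ψ hΨ).AllRules p

/-- Derivations: deductions from the empty set. -/
abbrev Derivation (D : PosOp L) {N : ℕ} (Cr : Fin (N + 1) → Critical L) (Θ : Sequent L) : Type :=
  Deduction D Cr ∅ Θ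

/-- The rule is one of the three `Cut` rules, and its main expression has rank at most `r`. -/
def PosOp.IsCutLE (D : PosOp L) (r : Ordinal.{0}) : Rule L → Prop
  | .cut e => D.rk e ≤ r
  | .cutOmTerm e => D.rk e ≤ r
  | .cutOmForm n => D.rk (.form n) ≤ r
  | .cutFr _ => False
  | .cutFrOmTerm _ => False
  | .fr _ => False
  | .h _ _ => False

/-- `F(Θ, C)`. -/
def PosOp.FSet (D : PosOp L) (Θ : Sequent L) (C : Set (Formula L 0)) : Set (Formula L 0) :=
  C ∪ {φ | ∃ e u, Θ.S e = some u ∧ e.IsTerm ∧ φ = D.F e u}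

/-- `ρ(Θ, C)`, the maximal simple rank of `|φ|_{Θ_S}` for `φ ∈ F(Θ, C)` (finite sets only). -/
def PosOp.rho (D : PosOp L) (Θ : Sequent L) (C : Set (Formula L 0)) : ℕ :=
  sSup {m | ∃ φ ∈ D.FSet Θ C, m = (φ.red Θ.S).rkS}

end Deductions

end EpsID1

end

noncomputable section

namespace EpsID1

variable {L : FirstOrder.Language.{0, 0}}

/-! Induction principles that do not descend into the names of Skolem functions. -/

-- The derivation is a search tree grown upwards from the empty sequent. `Cut` is applied until the
-- substitution contains every value that the critical formulas and the `H`-step can ask for, and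
-- then each leaf is an axiom. Since `Cut` hands out only the label `f`, no history of the search is
-- needed for `AxH`: any labelled active expression will do.
--
-- The tree is built by forcing. A property of sequents is `Forceable` if every reachable sequent is
-- cut-derivable as soon as all its extensions with that property are. Such properties are chained
-- in continuation style, and no separate termination measure on trees appears. The central lemma is
-- `forceable_det`: every well-formed closed formula of simple rank at most `r` can be decided. It
-- goes by induction on the simple rank. Deciding a formula means computing its terms, hence cutting
-- on canonical terms `c(v)`. After each such cut the value `u` is checked at once by deciding
-- `F(c(v), u)`, whose simple rank is smaller (`F_rkS_le`). After a cut on `c_n`, the formula `n ∈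
-- I` is settled too.
--
-- These checks are recorded in `Ext`, and they make a leaf that is not computationally inconsistent
-- correct (`correct_of_not_CI`): a decided `F(e, u)` that is not refuted is true. For `(n ∈ I, ⊤)`,
-- the term `c_n` is read as `0`, and `A(n, I)` follows from admissibility of the history and
-- positivity of `B`.
--
-- The search has two rounds. The first decides all critical formulas, reaching `Θ₀`; the second
-- supplies the data of the `H`-step, relative to the values and the sequence of `Θ₀` (`Prepared`).
-- The second round may lengthen the sequence. For Closure this is harmless, because a failing
-- instance already fails at an entry of the sequence of `Θ₀`. Finally `repair_active` shows that
-- each failing critical formula is repaired by a calculation inside the sequent, at an expression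
-- of value `?`, with a labelled active expression; so a correct nonsolving leaf is an instance of
-- `AxH`.

theorem Term.ind {n : ℕ} {p : Term L n → Prop} (var : ∀ i, p (.var i)) (zero : p .zero)
    (succ : ∀ t, p t → p (.succ t))
    (func : ∀ (k : ℕ) (f : L.Functions k) (ts : Fin k → Term L n), (∀ i, p (ts i)) →
      p (.func f ts))
    (skol : ∀ (k : ℕ) (φ : Formula L (k + 1)) (ts : Fin k → Term L n), (∀ i, p (ts i)) →
      p (.skol φ ts)) : ∀ t, p t
  | .var i => var i
  | .zero => zero
  | .succ t => succ t (Term.ind var zero succ func skol t)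
  | .func f ts => func _ f ts fun i => Term.ind var zero succ func skol (ts i)
  | .skol φ ts => skol _ φ ts fun i => Term.ind var zero succ func skol (ts i)

theorem Formula.ind {n : ℕ} {p : Formula L n → Prop} (top : p .top) (bot : p .bot)
    (eq : ∀ s t, p (.eq s t))
    (rel : ∀ (k : ℕ) (R : L.Relations k) (ts : Fin k → Term L n), p (.rel R ts))
    (mem : ∀ t, p (.mem t)) (neg : ∀ φ, p φ → p (.neg φ))
    (and : ∀ φ ψ, p φ → p ψ → p (.and φ ψ)) (or : ∀ φ ψ, p φ → p ψ → p (.or φ ψ)) : ∀ φ, p φ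
  | .top => top
  | .bot => bot
  | .eq s t => eq s t
  | .rel R ts => rel _ R ts
  | .mem t => mem t
  | .neg φ => neg φ (Formula.ind top bot eq rel mem neg and or φ)
  | .and φ ψ => and φ ψ (Formula.ind top bot eq rel mem neg and or φ)
      (Formula.ind top bot eq rel mem neg and or ψ)
  | .or φ ψ => or φ ψ (Formula.ind top bot eq rel mem neg and or φ)
      (Formula.ind top bot eq rel mem neg and or ψ)

/-! Numerals. -/

@[simp] theorem num?_numeral {n : ℕ} (m : ℕ) : (numeral m : Term L n).num? = some m := by
  induction m with
  | zero => rfl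
  | succ m ih => simp [numeral, Term.num?, ih]

theorem num?_eq_some {n : ℕ} {t : Term L n} {m : ℕ} : t.num? = some m ↔ t = numeral m := by
  refine ⟨?_, fun h => h ▸ num?_numeral m⟩
  induction t using Term.ind generalizing m with
  | zero => rintro h; cases h; rfl
  | succ t ih =>
    intro h
    obtain ⟨k, hk, rfl⟩ := Option.map_eq_some_iff.1 h
    rw [ih hk]; rfl
  | var i => intro h; cases h
  | func k f ts _ => intro h; cases h
  | skol k φ ts _ => intro h; cases h

theorem nums?_eq_some {n k : ℕ} {ts : Fin k → Term L n} {v : Fin k → ℕ} :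
    nums? ts = some v ↔ ∀ i, ts i = numeral (v i) := by
  unfold nums?
  constructor
  · intro h i
    split_ifs at h with hs
    cases h
    obtain ⟨m, hm⟩ := Option.isSome_iff_exists.1 (hs i)
    simp [num?_eq_some.1 hm]
  · intro h
    simp [h]

@[simp] theorem numeral_noSkol {n : ℕ} (m : ℕ) : (numeral m : Term L n).NoSkol := by
  induction m with
  | zero => trivial
  | succ m ih => exact ih

@[simp] theorem numeral_not_hasI {n : ℕ} (m : ℕ) : ¬ (numeral m : Term L n).HasI := by
  induction m with
  | zero => simp [numeral, Term.HasI]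
  | succ m ih => simpa [numeral, Term.HasI] using ih

@[simp] theorem numeral_wf {n : ℕ} (m : ℕ) : (numeral m : Term L n).WF := by
  induction m with
  | zero => simp [numeral, Term.WF]
  | succ m ih => simpa [numeral, Term.WF] using ih

@[simp] theorem numeral_rkS {n : ℕ} (m : ℕ) : (numeral m : Term L n).rkS = 0 := by
  induction m with
  | zero => simp [numeral, Term.rkS]
  | succ m ih => simpa [numeral, Term.rkS] using ih

@[simp] theorem val_numeral [L.Structure ℕ] {n : ℕ} (x : Fin n → ℕ) (m : ℕ) :
    (numeral m : Term L n).val x = m := by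
  induction m with
  | zero => rfl
  | succ m ih => simp [numeral, Term.val, ih]

/-! Well-formedness, simplicity and simple rank under substitution. -/

theorem Term.WF.subst {n m : ℕ} {σ : Fin n → Term L m} (hσ : ∀ i, (σ i).WF) {t : Term L n}
    (ht : t.WF) : (t.subst σ).WF := by
  induction t using Term.ind with
  | var i => exact hσ i
  | zero => simp [Term.subst, Term.WF]
  | succ t ih => simp only [Term.subst, Term.WF] at *; exact ih ht
  | func k f ts ih => simp only [Term.subst, Term.WF] at *; exact fun i => ih i (ht i)
  | skol k φ ts ih => simp only [Term.subst, Term.WF] at *; exact ⟨ht.1, fun i => ih i (ht.2 i)⟩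

theorem Formula.WF.subst {n m : ℕ} {σ : Fin n → Term L m} (hσ : ∀ i, (σ i).WF) {φ : Formula L n}
    (hφ : φ.WF) : (φ.subst σ).WF := by
  induction φ using Formula.ind with
  | top => simp [Formula.subst, Formula.WF]
  | bot => simp [Formula.subst, Formula.WF]
  | eq s t => simp only [Formula.subst, Formula.WF] at *; exact ⟨hφ.1.subst hσ, hφ.2.subst hσ⟩
  | rel k R ts => simp only [Formula.subst, Formula.WF] at *; exact fun i => (hφ i).subst hσ
  | mem t => simp only [Formula.subst, Formula.WF] at *; exact hφ.subst hσ
  | neg φ ih => simp only [Formula.subst, Formula.WF] at *; exact ih hφ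
  | and φ ψ ih ih' => simp only [Formula.subst, Formula.WF] at *; exact ⟨ih hφ.1, ih' hφ.2⟩
  | or φ ψ ih ih' => simp only [Formula.subst, Formula.WF] at *; exact ⟨ih hφ.1, ih' hφ.2⟩

theorem Term.NoSkol.wf {n : ℕ} {t : Term L n} (ht : t.NoSkol) : t.WF := by
  induction t using Term.ind with
  | var i => simp [Term.WF]
  | zero => simp [Term.WF]
  | succ t ih => simp only [Term.WF]; exact ih ht
  | func k f ts ih => simp only [Term.WF]; exact fun i => ih i (ht i)
  | skol k φ ts ih => exact ht.elim

theorem Formula.NoSkol.wf {n : ℕ} {φ : Formula L n} (hφ : φ.NoSkol) : φ.WF := by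
  induction φ using Formula.ind with
  | top => simp [Formula.WF]
  | bot => simp [Formula.WF]
  | eq s t => simp only [Formula.WF]; exact ⟨hφ.1.wf, hφ.2.wf⟩
  | rel k R ts => simp only [Formula.WF]; exact fun i => (hφ i).wf
  | mem t => simp only [Formula.WF]; exact Term.NoSkol.wf hφ
  | neg φ ih => simp only [Formula.WF]; exact ih hφ
  | and φ ψ ih ih' => simp only [Formula.WF]; exact ⟨ih hφ.1, ih' hφ.2⟩
  | or φ ψ ih ih' => simp only [Formula.WF]; exact ⟨ih hφ.1, ih' hφ.2⟩

theorem Term.NoSkol.rkS {n : ℕ} {t : Term L n} (ht : t.NoSkol) : t.rkS = 0 := by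
  induction t using Term.ind with
  | var i => simp [Term.rkS]
  | zero => simp [Term.rkS]
  | succ t ih => simp only [Term.rkS]; exact ih ht
  | func k f ts ih =>
    simp only [Term.rkS]
    exact Nat.le_zero.1 (Finset.sup_le fun i _ => (ih i (ht i)).le)
  | skol k φ ts ih => exact ht.elim

theorem Formula.NoSkol.rkS {n : ℕ} {φ : Formula L n} (hφ : φ.NoSkol) : φ.rkS = 0 := by
  induction φ using Formula.ind with
  | top => simp [Formula.rkS]
  | bot => simp [Formula.rkS]
  | eq s t => simp [Formula.rkS, hφ.1.rkS, hφ.2.rkS]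
  | rel k R ts =>
    simp only [Formula.rkS]
    exact Nat.le_zero.1 (Finset.sup_le fun i _ => (hφ i).rkS.le)
  | mem t => simp only [Formula.rkS]; exact Term.NoSkol.rkS hφ
  | neg φ ih => simp only [Formula.rkS]; exact ih hφ
  | and φ ψ ih ih' => simp [Formula.rkS, ih hφ.1, ih' hφ.2]
  | or φ ψ ih ih' => simp [Formula.rkS, ih hφ.1, ih' hφ.2]

theorem Term.NoSkol.subst {n m : ℕ} {σ : Fin n → Term L m} (hσ : ∀ i, (σ i).NoSkol)
    {t : Term L n} (ht : t.NoSkol) : (t.subst σ).NoSkol := by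
  induction t using Term.ind with
  | var i => exact hσ i
  | zero => trivial
  | succ t ih => exact ih ht
  | func k f ts ih => exact fun i => ih i (ht i)
  | skol k φ ts ih => exact ht.elim

theorem Formula.NoSkol.subst {n m : ℕ} {σ : Fin n → Term L m} (hσ : ∀ i, (σ i).NoSkol)
    {φ : Formula L n} (hφ : φ.NoSkol) : (φ.subst σ).NoSkol := by
  induction φ using Formula.ind with
  | top => trivial
  | bot => trivial
  | eq s t => exact ⟨hφ.1.subst hσ, hφ.2.subst hσ⟩
  | rel k R ts => exact fun i => (hφ i).subst hσ
  | mem t => exact Term.NoSkol.subst hσ hφ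
  | neg φ ih => exact ih hφ
  | and φ ψ ih ih' => exact ⟨ih hφ.1, ih' hφ.2⟩
  | or φ ψ ih ih' => exact ⟨ih hφ.1, ih' hφ.2⟩

theorem Term.subst_rkS_le {n m r : ℕ} {σ : Fin n → Term L m} (hσ : ∀ i, (σ i).rkS ≤ r)
    {t : Term L n} (ht : t.rkS ≤ r) : (t.subst σ).rkS ≤ r := by
  induction t using Term.ind with
  | var i => exact hσ i
  | zero => simp [Term.subst, Term.rkS]
  | succ t ih => simp only [Term.subst, Term.rkS] at *; exact ih ht
  | func k f ts ih =>
    simp only [Term.subst, Term.rkS, Finset.sup_le_iff, Finset.mem_univ, true_imp_iff] at *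
    exact fun i => ih i (ht i)
  | skol k φ ts ih =>
    simp only [Term.subst, Term.rkS, max_le_iff, Finset.sup_le_iff, Finset.mem_univ,
      true_imp_iff] at *
    exact ⟨ht.1, fun i => ih i (ht.2 i)⟩

theorem Formula.subst_rkS_le {n m r : ℕ} {σ : Fin n → Term L m} (hσ : ∀ i, (σ i).rkS ≤ r)
    {φ : Formula L n} (hφ : φ.rkS ≤ r) : (φ.subst σ).rkS ≤ r := by
  induction φ using Formula.ind with
  | top => simp [Formula.subst, Formula.rkS]
  | bot => simp [Formula.subst, Formula.rkS]
  | eq s t =>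
    simp only [Formula.subst, Formula.rkS, max_le_iff] at *
    exact ⟨Term.subst_rkS_le hσ hφ.1, Term.subst_rkS_le hσ hφ.2⟩
  | rel k R ts =>
    simp only [Formula.subst, Formula.rkS, Finset.sup_le_iff, Finset.mem_univ,
      true_imp_iff] at *
    exact fun i => Term.subst_rkS_le hσ (hφ i)
  | mem t => simp only [Formula.subst, Formula.rkS] at *; exact Term.subst_rkS_le hσ hφ
  | neg φ ih => simp only [Formula.subst, Formula.rkS] at *; exact ih hφ
  | and φ ψ ih ih' =>
    simp only [Formula.subst, Formula.rkS, max_le_iff] at *; exact ⟨ih hφ.1, ih' hφ.2⟩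
  | or φ ψ ih ih' =>
    simp only [Formula.subst, Formula.rkS, max_le_iff] at *; exact ⟨ih hφ.1, ih' hφ.2⟩

theorem Term.Simple.not_closed {n : ℕ} {t : Term L n} (ht : t.Simple) : ¬ t.Closed := by
  induction t using Term.ind with
  | var i => exact id
  | zero => exact ht.elim
  | succ t ih => exact ih ht
  | func k f ts ih => exact ht.1
  | skol k φ ts ih => exact ht.1

/-- Substituting terms that are not closed cannot create closed subterms; this is what preserves
simplicity. -/
theorem Term.closed_of_subst {n m : ℕ} {σ : Fin n → Term L m} (hσ : ∀ i, ¬ (σ i).Closed)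
    {t : Term L n} (ht : (t.subst σ).Closed) : t.Closed := by
  induction t using Term.ind with
  | var i => exact hσ i ht
  | zero => trivial
  | succ t ih => exact ih ht
  | func k f ts ih => exact fun i => ih i (ht i)
  | skol k φ ts ih => exact fun i => ih i (ht i)

theorem Term.Simple.subst {n m : ℕ} {σ : Fin n → Term L m} (hσ : ∀ i, (σ i).Simple)
    {t : Term L n} (ht : t.Simple) : (t.subst σ).Simple := by
  induction t using Term.ind with
  | var i => exact hσ i
  | zero => exact ht.elim
  | succ t ih => exact ih ht
  | func k f ts ih =>
    exact ⟨fun h => ht.1 (Term.closed_of_subst (t := .func f ts)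
      (fun i => (hσ i).not_closed) h), fun i => ih i (ht.2 i)⟩
  | skol k φ ts ih =>
    exact ⟨fun h => ht.1 (Term.closed_of_subst (t := .skol φ ts)
      (fun i => (hσ i).not_closed) h), fun i => ih i (ht.2 i)⟩

theorem Formula.Simple.subst {n m : ℕ} {σ : Fin n → Term L m} (hσ : ∀ i, (σ i).Simple)
    {φ : Formula L n} (hφ : φ.Simple) : (φ.subst σ).Simple := by
  induction φ using Formula.ind with
  | top => trivial
  | bot => trivial
  | eq s t => exact ⟨hφ.1.subst hσ, hφ.2.subst hσ⟩
  | rel k R ts => exact fun i => (hφ i).subst hσ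
  | mem t => exact Term.Simple.subst hσ hφ
  | neg φ ih => exact ih hφ
  | and φ ψ ih ih' => exact ⟨ih hφ.1, ih' hφ.2⟩
  | or φ ψ ih ih' => exact ⟨ih hφ.1, ih' hφ.2⟩

theorem Formula.plug_simple {n : ℕ} {χ : Term L n → Formula L n}
    (hχ : ∀ t : Term L n, t.Simple → (χ t).Simple) {φ : Formula L n} (hφ : φ.Simple) :
    (φ.plug χ).Simple := by
  induction φ using Formula.ind with
  | top => trivial
  | bot => trivial
  | eq s t => exact hφ
  | rel k R ts => exact hφ
  | mem t => exact hχ t hφ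
  | neg φ ih => exact ih hφ
  | and φ ψ ih ih' => exact ⟨ih hφ.1, ih' hφ.2⟩
  | or φ ψ ih ih' => exact ⟨ih hφ.1, ih' hφ.2⟩

theorem Formula.plug_wf {n : ℕ} {χ : Term L n → Formula L n}
    (hχ : ∀ t : Term L n, t.WF → (χ t).WF) {φ : Formula L n} (hφ : φ.WF) :
    (φ.plug χ).WF := by
  induction φ using Formula.ind with
  | top => simp [Formula.plug, Formula.WF]
  | bot => simp [Formula.plug, Formula.WF]
  | eq s t => exact hφ
  | rel k R ts => exact hφ
  | mem t => simp only [Formula.WF] at hφ; exact hχ t hφ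
  | neg φ ih => simp only [Formula.plug, Formula.WF] at *; exact ih hφ
  | and φ ψ ih ih' => simp only [Formula.plug, Formula.WF] at *; exact ⟨ih hφ.1, ih' hφ.2⟩
  | or φ ψ ih ih' => simp only [Formula.plug, Formula.WF] at *; exact ⟨ih hφ.1, ih' hφ.2⟩

theorem Formula.plug_rkS_le {n r : ℕ} {χ : Term L n → Formula L n}
    (hχ : ∀ t : Term L n, t.NoSkol → (χ t).rkS ≤ r) {φ : Formula L n} (hφ : φ.NoSkol) :
    (φ.plug χ).rkS ≤ r := by
  induction φ using Formula.ind with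
  | top => simp [Formula.plug, Formula.rkS]
  | bot => simp [Formula.plug, Formula.rkS]
  | eq s t => simp [Formula.plug, hφ.rkS]
  | rel k R ts => simp [Formula.plug, hφ.rkS]
  | mem t => exact hχ t hφ
  | neg φ ih => simp only [Formula.plug, Formula.rkS] at *; exact ih hφ
  | and φ ψ ih ih' =>
    simp only [Formula.plug, Formula.rkS, max_le_iff] at *; exact ⟨ih hφ.1, ih' hφ.2⟩
  | or φ ψ ih ih' =>
    simp only [Formula.plug, Formula.rkS, max_le_iff] at *; exact ⟨ih hφ.1, ih' hφ.2⟩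

/-! Occurrences of variables, outside the names of Skolem functions. -/

def Term.Occ {n : ℕ} (j : Fin n) : Term L n → Prop
  | .var i => i = j
  | .zero => False
  | .succ t => t.Occ j
  | .func _ ts => ∃ i, (ts i).Occ j
  | .skol _ ts => ∃ i, (ts i).Occ j

def Formula.Occ {n : ℕ} (j : Fin n) : Formula L n → Prop
  | .top => False
  | .bot => False
  | .eq s t => s.Occ j ∨ t.Occ j
  | .rel _ ts => ∃ i, (ts i).Occ j
  | .mem t => t.Occ j
  | .neg φ => φ.Occ j
  | .and φ ψ => φ.Occ j ∨ ψ.Occ j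
  | .or φ ψ => φ.Occ j ∨ ψ.Occ j

/-- At an occurrence of the variable the substituted term survives intact. Without an occurrence it
disappears, so a rank bound on `∃ x φ` bounds the rank of its Skolem term only if `x` really occurs
in `φ`. -/
theorem Term.Occ.rkS_le {n m : ℕ} {σ : Fin n → Term L m} {j : Fin n} {t : Term L n}
    (ht : t.Occ j) : (σ j).rkS ≤ (t.subst σ).rkS := by
  induction t using Term.ind with
  | var i => cases ht; exact le_rfl
  | zero => exact ht.elim
  | succ t ih => simp only [Term.subst, Term.rkS]; exact ih ht
  | func k f ts ih =>
    obtain ⟨i, hi⟩ := ht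
    simp only [Term.subst, Term.rkS]
    exact (ih i hi).trans (Finset.le_sup (f := fun i => ((ts i).subst σ).rkS) (Finset.mem_univ i))
  | skol k φ ts ih =>
    obtain ⟨i, hi⟩ := ht
    simp only [Term.subst, Term.rkS]
    exact ((ih i hi).trans
      (Finset.le_sup (f := fun i => ((ts i).subst σ).rkS) (Finset.mem_univ i))).trans
      (le_max_right _ _)

theorem Formula.Occ.rkS_le {n m : ℕ} {σ : Fin n → Term L m} {j : Fin n} {φ : Formula L n}
    (h : φ.Occ j) : (σ j).rkS ≤ (φ.subst σ).rkS := by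
  induction φ using Formula.ind with
  | top => exact h.elim
  | bot => exact h.elim
  | eq s t =>
    simp only [Formula.subst, Formula.rkS, le_max_iff]
    exact h.imp Term.Occ.rkS_le Term.Occ.rkS_le
  | rel k R ts =>
    obtain ⟨i, hi⟩ := h
    simp only [Formula.subst, Formula.rkS]
    exact hi.rkS_le.trans
      (Finset.le_sup (f := fun i => ((ts i).subst σ).rkS) (Finset.mem_univ i))
  | mem t => simp only [Formula.subst, Formula.rkS]; exact Term.Occ.rkS_le h
  | neg φ ih => simp only [Formula.subst, Formula.rkS]; exact ih h
  | and φ ψ ih ih' => simp only [Formula.subst, Formula.rkS, le_max_iff]; exact h.imp ih ih'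
  | or φ ψ ih ih' => simp only [Formula.subst, Formula.rkS, le_max_iff]; exact h.imp ih ih'

/-! Extensions of substitutions. -/

def Sub.Le (S T : Sub L) : Prop := ∀ e u, S e = some u → T e = some u

theorem Sub.Le.dom {S T : Sub L} (h : S.Le T) {e : CanExpr L} (he : e ∈ S.dom) : e ∈ T.dom := by
  obtain ⟨u, hu⟩ := Option.isSome_iff_exists.1 he
  simp [Sub.dom, h e u hu]

/-! The standard extension. -/

theorem Sub.mem_dom_bar {S : Sub L} {e : CanExpr L} (h : e.IsCanonical) : e ∈ S.bar.dom := by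
  unfold Sub.dom Sub.bar
  rcases hS : S e with _ | u <;> simp [hS, h]

theorem Sub.bar_eq_num {S : Sub L} {e : CanExpr L} {u : Val} (hu : u ≠ .unk) :
    S.bar e = some u ↔ S e = some u := by
  unfold Sub.bar
  rcases hS : S e with _ | w
  · by_cases hc : e.IsCanonical <;> simp [hc, hu.symm]
  · simp

/-! Evaluation in a substitution, with `?` and missing values read as `0` and `⊥`. -/

section Semantics

variable [L.Structure ℕ]

def Term.tv {n : ℕ} (S : Sub L) (x : Fin n → ℕ) : Term L n → ℕ
  | .var i => x i
  | .zero => 0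
  | .succ t => t.tv S x + 1
  | .func f ts => FirstOrder.Language.Structure.funMap f (fun i => (ts i).tv S x)
  | .skol φ ts =>
      match S (.term φ (fun i => (ts i).tv S x)) with
      | some (.num m) => m
      | _ => 0

def Formula.tv {n : ℕ} (S : Sub L) (x : Fin n → ℕ) : Formula L n → Prop
  | .top => True
  | .bot => False
  | .eq s t => s.tv S x = t.tv S x
  | .rel R ts => FirstOrder.Language.Structure.RelMap R (fun i => (ts i).tv S x)
  | .mem t => S (.form (t.tv S x)) = some .tt
  | .neg φ => ¬ φ.tv S x
  | .and φ ψ => φ.tv S x ∧ ψ.tv S x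
  | .or φ ψ => φ.tv S x ∨ ψ.tv S x

@[simp] theorem tv_imp {n : ℕ} (S : Sub L) (x : Fin n → ℕ) (φ ψ : Formula L n) :
    (φ.imp ψ).tv S x ↔ (φ.tv S x → ψ.tv S x) := by
  simp [Formula.imp, Formula.tv, imp_iff_not_or]

@[simp] theorem tv_numeral {n : ℕ} (S : Sub L) (x : Fin n → ℕ) (m : ℕ) :
    (numeral m : Term L n).tv S x = m := by
  induction m with
  | zero => rfl
  | succ m ih => simp [numeral, Term.tv, ih]

@[simp] theorem Term.tv_subst {n m : ℕ} (S : Sub L) (x : Fin m → ℕ) (σ : Fin n → Term L m)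
    (t : Term L n) : (t.subst σ).tv S x = t.tv S fun i => (σ i).tv S x := by
  induction t using Term.ind with
  | var i => rfl
  | zero => rfl
  | succ t ih => simp [Term.subst, Term.tv, ih]
  | func k f ts ih => simp [Term.subst, Term.tv, ih]
  | skol k φ ts ih => simp [Term.subst, Term.tv, ih]

@[simp] theorem Formula.tv_subst {n m : ℕ} (S : Sub L) (x : Fin m → ℕ) (σ : Fin n → Term L m)
    (φ : Formula L n) : (φ.subst σ).tv S x ↔ φ.tv S fun i => (σ i).tv S x := by
  induction φ using Formula.ind with
  | top => rfl
  | bot => rfl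
  | eq s t => simp [Formula.subst, Formula.tv]
  | rel k R ts => simp [Formula.subst, Formula.tv]
  | mem t => simp [Formula.subst, Formula.tv]
  | neg φ ih => simp [Formula.subst, Formula.tv, ih]
  | and φ ψ ih ih' => simp [Formula.subst, Formula.tv, ih, ih']
  | or φ ψ ih ih' => simp [Formula.subst, Formula.tv, ih, ih']

theorem Term.tv_congr {n : ℕ} {S : Sub L} {x y : Fin n → ℕ} {t : Term L n}
    (h : ∀ j, t.Occ j → x j = y j) : t.tv S x = t.tv S y := by
  induction t using Term.ind with
  | var i => exact h i rfl
  | zero => rfl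
  | succ t ih => simp only [Term.tv]; rw [ih h]
  | func k f ts ih =>
    have : (fun i => (ts i).tv S x) = fun i => (ts i).tv S y :=
      funext fun i => ih i fun j hj => h j ⟨i, hj⟩
    simp only [Term.tv, this]
  | skol k φ ts ih =>
    have : (fun i => (ts i).tv S x) = fun i => (ts i).tv S y :=
      funext fun i => ih i fun j hj => h j ⟨i, hj⟩
    simp only [Term.tv, this]

theorem Formula.tv_congr {n : ℕ} {S : Sub L} {x y : Fin n → ℕ} {φ : Formula L n}
    (h : ∀ j, φ.Occ j → x j = y j) : φ.tv S x ↔ φ.tv S y := by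
  induction φ using Formula.ind with
  | top => rfl
  | bot => rfl
  | eq s t =>
    simp only [Formula.tv]
    rw [Term.tv_congr fun j hj => h j (Or.inl hj), Term.tv_congr fun j hj => h j (Or.inr hj)]
  | rel k R ts =>
    have : (fun i => (ts i).tv S x) = fun i => (ts i).tv S y :=
      funext fun i => Term.tv_congr fun j hj => h j ⟨i, hj⟩
    simp only [Formula.tv, this]
  | mem t => simp only [Formula.tv]; rw [Term.tv_congr h]
  | neg φ ih => simp only [Formula.tv]; rw [ih h]
  | and φ ψ ih ih' =>
    simp only [Formula.tv]
    rw [ih fun j hj => h j (Or.inl hj), ih' fun j hj => h j (Or.inr hj)]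
  | or φ ψ ih ih' =>
    simp only [Formula.tv]
    rw [ih fun j hj => h j (Or.inl hj), ih' fun j hj => h j (Or.inr hj)]

/-- Used to exclude vacuous quantifiers: a critical formula that fails must have a matrix in which
the bound variable occurs, as otherwise its premise and conclusion would contradict the failure. -/
theorem Formula.tv_cons_congr {k : ℕ} {S : Sub L} {φ : Formula L (k + 1)} (h : ¬ φ.Occ 0)
    (a b : ℕ) (x : Fin k → ℕ) :
    φ.tv S (Fin.cons a x : Fin (k + 1) → ℕ) ↔ φ.tv S (Fin.cons b x : Fin (k + 1) → ℕ) := by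
  refine Formula.tv_congr fun j hj => ?_
  induction j using Fin.cases with
  | zero => exact (h hj).elim
  | succ j => rfl

theorem Term.NoSkol.tv_congr {n : ℕ} {S T : Sub L} {x : Fin n → ℕ} {t : Term L n}
    (ht : t.NoSkol) : t.tv S x = t.tv T x := by
  induction t using Term.ind with
  | var i => rfl
  | zero => rfl
  | succ t ih => simp only [Term.tv]; rw [ih ht]
  | func k f ts ih =>
    have : (fun i => (ts i).tv S x) = fun i => (ts i).tv T x := funext fun i => ih i (ht i)
    simp only [Term.tv, this]
  | skol k φ ts ih => exact ht.elim

/-- Positive formulas without Skolem functions are monotone in `I`. -/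
theorem Formula.tv_mono {n : ℕ} {S T : Sub L} (h : ∀ m, S (.form m) = some .tt →
    T (.form m) = some .tt) {x : Fin n → ℕ} {φ : Formula L n} (hφ : φ.NoSkol) :
    (φ.Polar true → φ.tv S x → φ.tv T x) ∧ (φ.Polar false → φ.tv T x → φ.tv S x) := by
  induction φ using Formula.ind with
  | top => simp [Formula.tv]
  | bot => simp [Formula.tv]
  | eq s t =>
    simp [Formula.tv, hφ.1.tv_congr (S := S) (T := T), hφ.2.tv_congr (S := S) (T := T)]
  | rel k R ts =>
    have : (fun i => (ts i).tv S x) = fun i => (ts i).tv T x :=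
      funext fun i => (hφ i).tv_congr
    simp [Formula.tv, this]
  | mem t =>
    simp only [Formula.tv, Formula.Polar]
    rw [Term.NoSkol.tv_congr (S := S) (T := T) hφ]
    exact ⟨fun _ => h _, by simp⟩
  | neg φ ih =>
    simp only [Formula.tv, Formula.Polar]
    exact ⟨fun hp hn hs => hn ((ih hφ).2 hp hs), fun hp hn hs => hn ((ih hφ).1 hp hs)⟩
  | and φ ψ ih ih' =>
    simp only [Formula.tv, Formula.Polar]
    exact ⟨fun hp => And.imp ((ih hφ.1).1 hp.1) ((ih' hφ.2).1 hp.2),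
      fun hp => And.imp ((ih hφ.1).2 hp.1) ((ih' hφ.2).2 hp.2)⟩
  | or φ ψ ih ih' =>
    simp only [Formula.tv, Formula.Polar]
    exact ⟨fun hp => Or.imp ((ih hφ.1).1 hp.1) ((ih' hφ.2).1 hp.2),
      fun hp => Or.imp ((ih hφ.1).2 hp.1) ((ih' hφ.2).2 hp.2)⟩

/-! Reduction of closed expressions. -/

theorem red_func_some {n k : ℕ} {S : Sub L} {f : L.Functions k} {ts : Fin k → Term L n}
    {v : Fin k → ℕ} (h : ∀ i, (ts i).red S = numeral (v i)) :
    (Term.func f ts).red S = numeral (FirstOrder.Language.Structure.funMap f v) := by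
  simp only [Term.red, nums?_eq_some.2 h]

theorem red_skol_num {n k : ℕ} {S : Sub L} {φ : Formula L (k + 1)} {ts : Fin k → Term L n}
    {v : Fin k → ℕ} (h : ∀ i, (ts i).red S = numeral (v i)) :
    (Term.skol φ ts).red S = match S (.term φ v) with
      | some (.num m) => numeral m
      | some _ => .zero
      | none => .skol φ (fun i => (ts i).red S) := by
  simp only [Term.red, nums?_eq_some.2 h]

theorem red_mem_num {n : ℕ} {S : Sub L} {t : Term L n} {m : ℕ} (h : t.red S = numeral m) :
    (Formula.mem t).red S = match S (.form m) with
      | some .tt => .top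
      | some _ => .bot
      | none => .mem (t.red S) := by
  simp only [Formula.red, h, num?_numeral]

theorem red_skol_dom {n k : ℕ} {S : Sub L} {φ : Formula L (k + 1)} {ts : Fin k → Term L n}
    {v : Fin k → ℕ} (h : ∀ i, (ts i).red S = numeral (v i)) (hd : .term φ v ∈ S.dom) :
    ∃ m, (Term.skol φ ts).red S = numeral m := by
  obtain ⟨u, hu⟩ := Option.isSome_iff_exists.1 hd
  rw [red_skol_num h, hu]
  cases u with
  | num m => exact ⟨m, rfl⟩
  | unk => exact ⟨0, rfl⟩
  | tt => exact ⟨0, rfl⟩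

theorem Term.red_func_cases {n k : ℕ} (S : Sub L) (f : L.Functions k) (ts : Fin k → Term L n) :
    (∃ v : Fin k → ℕ, ∀ i, (ts i).red S = numeral (v i)) ∨
      (Term.func f ts).red S = .func f (fun i => (ts i).red S) := by
  rcases h : nums? (fun i => (ts i).red S) with _ | v
  · right; simp only [Term.red, h]
  · left; exact ⟨v, nums?_eq_some.1 h⟩

theorem Term.red_skol_cases {n k : ℕ} (S : Sub L) (φ : Formula L (k + 1))
    (ts : Fin k → Term L n) :
    (∃ v : Fin k → ℕ, (∀ i, (ts i).red S = numeral (v i)) ∧ .term φ v ∈ S.dom) ∨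
      (Term.skol φ ts).red S = .skol φ (fun i => (ts i).red S) := by
  rcases h : nums? (fun i => (ts i).red S) with _ | v
  · right; simp only [Term.red, h]
  · rcases hd : S (.term φ v) with _ | u
    · right; simp only [Term.red, h, hd]
    · left; exact ⟨v, nums?_eq_some.1 h, by simp [Sub.dom, hd]⟩

/-- A closed term whose reduction has no Skolem functions reduces to the numeral of its value. -/
theorem Term.red_eq_numeral {S : Sub L} {t : Term L 0} (h : (t.red S).NoSkol) :
    t.red S = numeral (t.tv S Fin.elim0) := by
  induction t using Term.ind with
  | var i => exact i.elim0
  | zero => rfl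
  | succ t ih => simp only [Term.red, Term.tv, numeral]; rw [ih h]
  | func k f ts ih =>
    have key : ∀ i, (ts i).red S = numeral ((ts i).tv S Fin.elim0) := by
      rcases Term.red_func_cases S f ts with ⟨v, hv⟩ | h'
      · exact fun i => ih i (by simp [hv i])
      · rw [h'] at h; exact fun i => ih i (h i)
    rw [red_func_some key]; rfl
  | skol k φ ts ih =>
    rcases Term.red_skol_cases S φ ts with ⟨v, hv, hd⟩ | h'
    · have key : ∀ i, (ts i).red S = numeral ((ts i).tv S Fin.elim0) :=
        fun i => ih i (by simp [hv i])
      rw [red_skol_num key]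
      simp only [Term.tv]
      have : v = fun i => (ts i).tv S Fin.elim0 := by
        funext i
        have := (hv i).symm.trans (key i)
        simpa using congrArg Term.num? this
      rw [← this]
      obtain ⟨u, hu⟩ := Option.isSome_iff_exists.1 hd
      rw [hu]
      cases u <;> rfl
    · rw [h'] at h; exact h.elim

theorem Sub.computes_iff {S : Sub L} {t : Term L 0} : S.Computes t ↔ (t.red S).NoSkol := by
  unfold Sub.Computes
  refine ⟨fun h => ?_, fun h => by simp [Term.red_eq_numeral h]⟩
  obtain ⟨m, hm⟩ := Option.isSome_iff_exists.1 h
  simp [num?_eq_some.1 hm]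

theorem Sub.Computes.red {S : Sub L} {t : Term L 0} (h : S.Computes t) :
    t.red S = numeral (t.tv S Fin.elim0) := Term.red_eq_numeral (Sub.computes_iff.1 h)

theorem computes_of_red {S : Sub L} {t : Term L 0} {m : ℕ} (h : t.red S = numeral m) :
    S.Computes t := by simp [Sub.Computes, h]

theorem computes_succ {S : Sub L} {t : Term L 0} : S.Computes (.succ t) ↔ S.Computes t := by
  simp [Sub.computes_iff, Term.red, Term.NoSkol]

theorem computes_func {S : Sub L} {k : ℕ} {f : L.Functions k} {ts : Fin k → Term L 0} :
    S.Computes (.func f ts) ↔ ∀ i, S.Computes (ts i) := by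
  refine ⟨fun h => ?_, fun h => computes_of_red (red_func_some fun i => (h i).red)⟩
  rcases Term.red_func_cases S f ts with ⟨v, hv⟩ | h'
  · exact fun i => computes_of_red (hv i)
  · rw [Sub.computes_iff, h'] at h
    exact fun i => Sub.computes_iff.2 (h i)

theorem computes_skol {S : Sub L} {k : ℕ} {φ : Formula L (k + 1)} {ts : Fin k → Term L 0} :
    S.Computes (.skol φ ts) ↔ (∀ i, S.Computes (ts i)) ∧
      .term φ (fun i => (ts i).tv S Fin.elim0) ∈ S.dom := by
  constructor
  · intro h
    rcases Term.red_skol_cases S φ ts with ⟨v, hv, hd⟩ | h'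
    · have hc : ∀ i, S.Computes (ts i) := fun i => computes_of_red (hv i)
      refine ⟨hc, ?_⟩
      convert hd using 2
      funext i
      simpa using congrArg Term.num? ((hc i).red.symm.trans (hv i))
    · rw [Sub.computes_iff, h'] at h; exact h.elim
  · rintro ⟨h, hd⟩
    obtain ⟨m, hm⟩ := red_skol_dom (fun i => (h i).red) hd
    exact computes_of_red hm

/-- The reduction of the formula is a sentence of arithmetic. -/
def Sub.Det (S : Sub L) (φ : Formula L 0) : Prop := (φ.red S).IsArith

theorem det_top (S : Sub L) : S.Det .top := ⟨trivial, by simp [Formula.red, Formula.HasI]⟩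

theorem det_bot (S : Sub L) : S.Det .bot := ⟨trivial, by simp [Formula.red, Formula.HasI]⟩

theorem det_neg {S : Sub L} {φ : Formula L 0} : S.Det φ.neg ↔ S.Det φ := by
  simp [Sub.Det, Formula.IsArith, Formula.red, Formula.HasI, Formula.NoSkol]

theorem det_and {S : Sub L} {φ ψ : Formula L 0} : S.Det (φ.and ψ) ↔ S.Det φ ∧ S.Det ψ := by
  simp only [Sub.Det, Formula.IsArith, Formula.red, Formula.HasI, Formula.NoSkol]; tauto

theorem det_or {S : Sub L} {φ ψ : Formula L 0} : S.Det (φ.or ψ) ↔ S.Det φ ∧ S.Det ψ := by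
  simp only [Sub.Det, Formula.IsArith, Formula.red, Formula.HasI, Formula.NoSkol]; tauto

theorem det_imp {S : Sub L} {φ ψ : Formula L 0} : S.Det (φ.imp ψ) ↔ S.Det φ ∧ S.Det ψ := by
  rw [Formula.imp, det_or, det_neg]

theorem det_eq {S : Sub L} {s t : Term L 0} : S.Det (.eq s t) ↔ S.Computes s ∧ S.Computes t := by
  rw [Sub.computes_iff, Sub.computes_iff]
  refine ⟨fun h => h.1, fun h => ⟨h, ?_⟩⟩
  simp [Formula.red, Formula.HasI, Term.red_eq_numeral h.1, Term.red_eq_numeral h.2]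

theorem det_rel {S : Sub L} {k : ℕ} {R : L.Relations k} {ts : Fin k → Term L 0} :
    S.Det (.rel R ts) ↔ ∀ i, S.Computes (ts i) := by
  simp_rw [Sub.computes_iff]
  refine ⟨fun h => h.1, fun h => ⟨h, ?_⟩⟩
  simp [Formula.red, Formula.HasI, fun i => Term.red_eq_numeral (h i)]

theorem det_mem {S : Sub L} {t : Term L 0} :
    S.Det (.mem t) ↔ S.Computes t ∧ .form (t.tv S Fin.elim0) ∈ S.dom := by
  constructor
  · intro h
    have hc : S.Computes t := by
      unfold Sub.Computes
      by_contra hn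
      rw [Option.not_isSome_iff_eq_none] at hn
      have h' := h.2
      simp only [Formula.red, hn, Formula.HasI, not_true] at h'
    refine ⟨hc, ?_⟩
    by_contra hd
    have hd : S (.form (t.tv S Fin.elim0)) = none := by simpa [Sub.dom] using hd
    have h' := h.2
    simp only [red_mem_num hc.red, hd, Formula.HasI, not_true] at h'
  · rintro ⟨hc, hd⟩
    obtain ⟨u, hu⟩ := Option.isSome_iff_exists.1 hd
    unfold Sub.Det
    rw [red_mem_num hc.red, hu]
    cases u <;> exact ⟨trivial, by simp [Formula.HasI]⟩

theorem Sub.Det.holds_iff {S : Sub L} {φ : Formula L 0} (h : S.Det φ) :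
    (φ.red S).Holds ↔ φ.tv S Fin.elim0 := by
  unfold Formula.Holds
  induction φ using Formula.ind with
  | top => rfl
  | bot => rfl
  | eq s t =>
    obtain ⟨hs, ht⟩ := det_eq.1 h
    simp [Formula.red, Formula.Realize, Formula.tv, hs.red, ht.red]
  | rel k R ts =>
    have hs := det_rel.1 h
    simp [Formula.red, Formula.Realize, Formula.tv, fun i => (hs i).red]
  | mem t =>
    obtain ⟨hc, hd⟩ := det_mem.1 h
    obtain ⟨u, hu⟩ := Option.isSome_iff_exists.1 hd
    rw [red_mem_num hc.red, Formula.tv, hu]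
    cases u <;> simp [Formula.Realize]
  | neg φ ih => simp only [Formula.red, Formula.Realize, Formula.tv]; rw [ih (det_neg.1 h)]
  | and φ ψ ih ih' =>
    simp only [Formula.red, Formula.Realize, Formula.tv]
    rw [ih (det_and.1 h).1, ih' (det_and.1 h).2]
  | or φ ψ ih ih' =>
    simp only [Formula.red, Formula.Realize, Formula.tv]
    rw [ih (det_or.1 h).1, ih' (det_or.1 h).2]

theorem Sub.sat_iff {S : Sub L} {φ : Formula L 0} :
    S.Sat φ ↔ S.Det φ ∧ φ.tv S Fin.elim0 :=
  ⟨fun h => ⟨h.1, (Sub.Det.holds_iff h.1).1 h.2⟩, fun h => ⟨h.1, h.1.holds_iff.2 h.2⟩⟩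

/-- An arithmetical sentence is true or false, so being decided only requires that the reduction be
arithmetical. -/
theorem Sub.decides_iff {S : Sub L} {φ : Formula L 0} : S.Decides φ ↔ S.Det φ := by
  unfold Sub.Decides
  rw [Sub.sat_iff, Sub.sat_iff, det_neg]
  simp only [Formula.tv]; tauto

/-- A calculation inside `S` consults only values present in `S`, so it runs identically in every
extension. -/
theorem Sub.Computes.mono {S T : Sub L} (h : S.Le T) {t : Term L 0} (ht : S.Computes t) :
    T.Computes t ∧ t.tv T Fin.elim0 = t.tv S Fin.elim0 := by
  induction t using Term.ind with
  | var i => exact i.elim0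
  | zero => exact ⟨rfl, rfl⟩
  | succ t ih =>
    have := ih (computes_succ.1 ht)
    exact ⟨computes_succ.2 this.1, by simp [Term.tv, this.2]⟩
  | func k f ts ih =>
    have := fun i => ih i (computes_func.1 ht i)
    exact ⟨computes_func.2 fun i => (this i).1, by simp [Term.tv, fun i => (this i).2]⟩
  | skol k φ ts ih =>
    obtain ⟨hc, hd⟩ := computes_skol.1 ht
    have := fun i => ih i (hc i)
    obtain ⟨u, hu⟩ := Option.isSome_iff_exists.1 hd
    have e : (fun i => (ts i).tv T Fin.elim0) = fun i => (ts i).tv S Fin.elim0 :=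
      funext fun i => (this i).2
    exact ⟨computes_skol.2 ⟨fun i => (this i).1, by rw [e]; exact h.dom hd⟩,
      by simp only [Term.tv]; rw [e, hu, h _ _ hu]⟩

theorem Sub.Det.mono {S T : Sub L} (h : S.Le T) {φ : Formula L 0} (hφ : S.Det φ) : T.Det φ := by
  induction φ using Formula.ind with
  | top => exact det_top T
  | bot => exact det_bot T
  | eq s t => exact det_eq.2 ⟨((det_eq.1 hφ).1.mono h).1, ((det_eq.1 hφ).2.mono h).1⟩
  | rel k R ts => exact det_rel.2 fun i => ((det_rel.1 hφ i).mono h).1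
  | mem t =>
    obtain ⟨hc, hd⟩ := det_mem.1 hφ
    have := hc.mono h
    exact det_mem.2 ⟨this.1, by rw [this.2]; exact h.dom hd⟩
  | neg φ ih => exact det_neg.2 (ih (det_neg.1 hφ))
  | and φ ψ ih ih' => exact det_and.2 ⟨ih (det_and.1 hφ).1, ih' (det_and.1 hφ).2⟩
  | or φ ψ ih ih' => exact det_or.2 ⟨ih (det_or.1 hφ).1, ih' (det_or.1 hφ).2⟩

/-- If the variable `j` occurs, then the term substituted for it has to be computed. -/
theorem Term.Occ.computes {n : ℕ} {S : Sub L} {σ : Fin n → Term L 0} {j : Fin n} {t : Term L n}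
    (hj : t.Occ j) (h : S.Computes (t.subst σ)) : S.Computes (σ j) := by
  induction t using Term.ind with
  | var i => cases hj; exact h
  | zero => exact hj.elim
  | succ t ih => exact ih hj (computes_succ.1 h)
  | func k f ts ih => obtain ⟨i, hi⟩ := hj; exact ih i hi (computes_func.1 h i)
  | skol k φ ts ih => obtain ⟨i, hi⟩ := hj; exact ih i hi ((computes_skol.1 h).1 i)

theorem Formula.Occ.computes {n : ℕ} {S : Sub L} {σ : Fin n → Term L 0} {j : Fin n}
    {φ : Formula L n} (hj : φ.Occ j) (h : S.Det (φ.subst σ)) : S.Computes (σ j) := by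
  induction φ using Formula.ind with
  | top => exact hj.elim
  | bot => exact hj.elim
  | eq s t => exact hj.elim (·.computes (det_eq.1 h).1) (·.computes (det_eq.1 h).2)
  | rel k R ts => obtain ⟨i, hi⟩ := hj; exact hi.computes (det_rel.1 h i)
  | mem t => exact Term.Occ.computes hj (det_mem.1 h).1
  | neg φ ih => exact ih hj (det_neg.1 h)
  | and φ ψ ih ih' => exact hj.elim (ih · (det_and.1 h).1) (ih' · (det_and.1 h).2)
  | or φ ψ ih ih' => exact hj.elim (ih · (det_or.1 h).1) (ih' · (det_or.1 h).2)

/-- Evaluation already treats a missing value like `?`. Hence `S` and its standard extension never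
disagree about truth; they differ only in what they compute or determine. -/
theorem Term.tv_bar {n : ℕ} (S : Sub L) (x : Fin n → ℕ) (t : Term L n) :
    t.tv S.bar x = t.tv S x := by
  induction t using Term.ind with
  | var i => rfl
  | zero => rfl
  | succ t ih => simp only [Term.tv, ih]
  | func k f ts ih => simp only [Term.tv, ih]
  | skol k φ ts ih =>
    simp only [Term.tv, ih]
    rcases hS : S (.term φ fun i => (ts i).tv S x) with _ | u
    · by_cases hc : CanExpr.IsCanonical (.term φ fun i => (ts i).tv S x) <;>
        simp [Sub.bar, hS, hc]
    · simp [Sub.bar, hS]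

theorem Formula.tv_bar {n : ℕ} (S : Sub L) (x : Fin n → ℕ) (φ : Formula L n) :
    φ.tv S.bar x ↔ φ.tv S x := by
  induction φ using Formula.ind with
  | top => rfl
  | bot => rfl
  | eq s t => simp only [Formula.tv, Term.tv_bar]
  | rel k R ts => simp only [Formula.tv, Term.tv_bar]
  | mem t => simp only [Formula.tv, Term.tv_bar]; exact Sub.bar_eq_num (by simp)
  | neg φ ih => simp only [Formula.tv, ih]
  | and φ ψ ih ih' => simp only [Formula.tv, ih, ih']
  | or φ ψ ih ih' => simp only [Formula.tv, ih, ih']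

/-- Well-formedness matters because the standard extension is total only on canonical expressions,
and the Skolem terms met during reduction are canonical exactly when their names are simple and
well-formed. -/
theorem Term.WF.computes_bar {S : Sub L} {t : Term L 0} (ht : t.WF) : S.bar.Computes t := by
  induction t using Term.ind with
  | var i => exact i.elim0
  | zero => rfl
  | succ t ih => simp only [Term.WF] at ht; exact computes_succ.2 (ih ht)
  | func k f ts ih => simp only [Term.WF] at ht; exact computes_func.2 fun i => ih i (ht i)
  | skol k φ ts ih =>
    simp only [Term.WF] at ht
    exact computes_skol.2 ⟨fun i => ih i (ht.2 i), Sub.mem_dom_bar ht.1⟩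

theorem Formula.WF.det_bar {S : Sub L} {φ : Formula L 0} (hφ : φ.WF) : S.bar.Det φ := by
  induction φ using Formula.ind with
  | top => exact det_top _
  | bot => exact det_bot _
  | eq s t =>
    simp only [Formula.WF] at hφ; exact det_eq.2 ⟨hφ.1.computes_bar, hφ.2.computes_bar⟩
  | rel k R ts => simp only [Formula.WF] at hφ; exact det_rel.2 fun i => (hφ i).computes_bar
  | mem t =>
    simp only [Formula.WF] at hφ
    exact det_mem.2 ⟨hφ.computes_bar, Sub.mem_dom_bar trivial⟩
  | neg φ ih => simp only [Formula.WF] at hφ; exact det_neg.2 (ih hφ)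
  | and φ ψ ih ih' => simp only [Formula.WF] at hφ; exact det_and.2 ⟨ih hφ.1, ih' hφ.2⟩
  | or φ ψ ih ih' => simp only [Formula.WF] at hφ; exact det_or.2 ⟨ih hφ.1, ih' hφ.2⟩

theorem Formula.WF.sat_bar {S : Sub L} {φ : Formula L 0} (hφ : φ.WF) :
    S.bar.Sat φ ↔ φ.tv S Fin.elim0 := by
  rw [Sub.sat_iff, Formula.tv_bar]
  exact and_iff_right hφ.det_bar

theorem Term.WF.ev_eq {S : Sub L} {t : Term L 0} (ht : t.WF) : S.ev t = t.tv S Fin.elim0 := by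
  rw [Sub.ev, (ht.computes_bar (S := S)).red, num?_numeral, Term.tv_bar]
  rfl

/-- Reduction under the empty substitution does not lower the simple rank. -/
theorem Term.rkS_le_red_empty (t : Term L 0) : t.rkS ≤ (t.red fun _ => none).rkS := by
  induction t using Term.ind with
  | var i => exact i.elim0
  | zero => rfl
  | succ t ih => simp only [Term.red, Term.rkS]; exact ih
  | func k f ts ih =>
    rcases Term.red_func_cases (fun _ => none) f ts with ⟨v, hv⟩ | h
    -- All arguments reduce to numerals, so by induction their simple ranks were already `0`.
    · simp only [Term.rkS]
      refine le_trans (Finset.sup_le fun i _ => ?_) (Nat.zero_le _)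
      have := ih i
      rwa [hv i, numeral_rkS] at this
    · rw [h]
      simp only [Term.rkS]
      exact Finset.sup_mono_fun fun i _ => ih i
  | skol k φ ts ih =>
    rcases Term.red_skol_cases (fun _ => none) φ ts with ⟨v, hv, hd⟩ | h
    · simp [Sub.dom] at hd
    · rw [h]
      simp only [Term.rkS]
      exact max_le_max le_rfl (Finset.sup_mono_fun fun i _ => ih i)

theorem Formula.rkS_le_red_empty (φ : Formula L 0) : φ.rkS ≤ (φ.red fun _ => none).rkS := by
  induction φ using Formula.ind with
  | top => rfl
  | bot => rfl
  | eq s t =>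
    simp only [Formula.red, Formula.rkS]
    exact max_le_max s.rkS_le_red_empty t.rkS_le_red_empty
  | rel k R ts =>
    simp only [Formula.red, Formula.rkS]
    exact Finset.sup_mono_fun fun i _ => (ts i).rkS_le_red_empty
  | mem t =>
    have : (Formula.mem t).red (fun _ => none) = .mem (t.red fun _ => none) := by
      simp only [Formula.red]
      split <;> rfl
    rw [this]
    simp only [Formula.rkS]
    exact t.rkS_le_red_empty
  | neg φ ih => simp only [Formula.red, Formula.rkS]; exact ih
  | and φ ψ ih ih' => simp only [Formula.red, Formula.rkS]; exact max_le_max ih ih'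
  | or φ ψ ih ih' => simp only [Formula.red, Formula.rkS]; exact max_le_max ih ih'

end Semantics

/-! Ranks. -/

@[simp] theorem rk_form (D : PosOp L) (n : ℕ) : D.rk (.form n) = Om := rfl

@[simp] theorem rk_c (D : PosOp L) (n : ℕ) : D.rk (D.c n) = Om := if_pos ⟨n, rfl⟩

theorem natCast_lt_Om (n : ℕ) : (n : Ordinal.{0}) < Om :=
  (Ordinal.natCast_lt_omega0 n).trans Ordinal.omega0_lt_omega_one

theorem Om_le_bound (r : ℕ) : Om ≤ Om + (r : Ordinal.{0}) + 1 :=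
  le_self_add.trans le_self_add

/-- The worst case is a name containing `I`, of rank `Ω` plus the simple rank plus one; this is
where the final `+ 1` of the bound comes from. -/
theorem rk_term_le (D : PosOp L) {k r : ℕ} {φ : Formula L (k + 1)} (v : Fin k → ℕ)
    (h : φ.rkS + 1 ≤ r) : D.rk (.term φ v) ≤ Om + (r : Ordinal.{0}) + 1 := by
  simp only [PosOp.rk]
  split_ifs with h1 h2
  · exact Om_le_bound r
  · have : ((φ.rkS + 1 : ℕ) : Ordinal.{0}) ≤ (r : Ordinal.{0}) := by exact_mod_cast h
    gcongr
  · exact (natCast_lt_Om _).le.trans (Om_le_bound r)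

theorem c_canonical (D : PosOp L) : D.B.neg.Simple ∧ D.B.neg.WF := by
  refine ⟨D.simple, ?_⟩
  simp only [Formula.WF]
  exact D.noSkol.wf

theorem cons_wf {k n : ℕ} {t : Term L n} {s : Fin k → Term L n} (ht : t.WF)
    (hs : ∀ i, (s i).WF) (i : Fin (k + 1)) :
    ((Fin.cons t s : Fin (k + 1) → Term L n) i).WF := by
  induction i using Fin.cases with
  | zero => exact ht
  | succ i => exact hs i

theorem cons_rkS_le {k n r : ℕ} {t : Term L n} {s : Fin k → Term L n} (ht : t.rkS ≤ r)
    (hs : ∀ i, (s i).rkS ≤ r) (i : Fin (k + 1)) :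
    ((Fin.cons t s : Fin (k + 1) → Term L n) i).rkS ≤ r := by
  induction i using Fin.cases with
  | zero => exact ht
  | succ i => exact hs i

theorem inst_wf {k n : ℕ} {φ : Formula L (k + 1)} {t : Term L n} {s : Fin k → Term L n}
    (hφ : φ.WF) (hs : ∀ i, (s i).WF) (ht : t.WF) : (inst φ s t).WF :=
  hφ.subst (cons_wf ht hs)

theorem inst_rkS_le {k n r : ℕ} {φ : Formula L (k + 1)} {t : Term L n} {s : Fin k → Term L n}
    (hφ : φ.rkS ≤ r) (hs : ∀ i, (s i).rkS ≤ r) (ht : t.rkS ≤ r) : (inst φ s t).rkS ≤ r :=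
  Formula.subst_rkS_le (cons_rkS_le ht hs) hφ

theorem conjNeg_wf {φ : ℕ → Formula L 0} (h : ∀ u, (φ u).WF) (u : ℕ) : (conjNeg φ u).WF := by
  induction u with
  | zero => simp [conjNeg, Formula.WF]
  | succ u ih => simp [conjNeg, Formula.WF, ih, h]

theorem conjNeg_rkS_le {φ : ℕ → Formula L 0} {r : ℕ} (h : ∀ u, (φ u).rkS ≤ r) (u : ℕ) :
    (conjNeg φ u).rkS ≤ r := by
  induction u with
  | zero => simp [conjNeg, Formula.rkS]
  | succ u ih => simp [conjNeg, Formula.rkS, ih, h]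

theorem F_wf (D : PosOp L) {k : ℕ} {φ : Formula L (k + 1)} (hφ : φ.WF) (v : Fin k → ℕ) (u : ℕ) :
    (D.F (.term φ v) (.num u)).WF := by
  have : ∀ u, (instNum φ v u).WF := fun u => inst_wf hφ (by simp) (by simp)
  simp only [PosOp.F, Formula.WF]
  exact ⟨this u, conjNeg_wf this u⟩

/-- Only numerals are substituted into `φ`, so `F(e, u)` lies at the level of the name of the Skolem
function, strictly below the simple rank of `e`. The recursion in `forceable_det` rests on this
drop. -/
theorem F_rkS_le (D : PosOp L) {k : ℕ} (φ : Formula L (k + 1)) (v : Fin k → ℕ) (u : ℕ) :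
    (D.F (.term φ v) (.num u)).rkS ≤ φ.rkS := by
  have : ∀ u, (instNum φ v u).rkS ≤ φ.rkS := fun u => inst_rkS_le le_rfl (by simp) (by simp)
  simp only [PosOp.F, Formula.rkS, max_le_iff]
  exact ⟨this u, conjNeg_rkS_le this u⟩

-- Cut-derivability as a forcing relation on sequents

section Forcing

variable [L.Structure ℕ]

/-- There is a derivation of `Θ` by `Cut`-inferences of rank at most `Ω + r + 1`. -/
def CutDerivable (D : PosOp L) {N : ℕ} (Cr : Fin (N + 1) → Critical L) (r : ℕ) (Θ : Sequent L) :
    Prop :=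
  ∃ d : Derivation D Cr Θ, d.AllRules (D.IsCutLE (Om + (r : Ordinal.{0}) + 1))

theorem CutDerivable.inf {D : PosOp L} {N : ℕ} {Cr : Fin (N + 1) → Critical L} {r : ℕ}
    {Θ : Sequent L} (hs : D.IsSequent Θ) (R : Rule L)
    (hR : D.IsCutLE (Om + (r : Ordinal.{0}) + 1) R) (h : D.Applicable Cr Θ R)
    (hp : ∀ Ψ, D.IsPremise Θ Ψ R → CutDerivable D Cr r Ψ) : CutDerivable D Cr r Θ := by
  choose d hd using hp
  exact ⟨.inf Θ hs R h d, hR, hd⟩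

/-- The sequents which arise in derivations by `Cut` rules from the empty sequent. -/
structure Reachable (D : PosOp L) (Θ : Sequent L) : Prop where
  isSequent : D.IsSequent Θ
  label : ∀ e b, Θ.F e = some b → b = false
  admissible : D.Admissible Θ.P

/-- `Θ'` extends `Θ`, decides `F(e, u)` for every new value `u` of a term, and has `n ∈ I` in its
domain whenever `c_n` is new. -/
structure Ext (D : PosOp L) (Θ Θ' : Sequent L) : Prop where
  le : Θ.S.Le Θ'.S
  P : ∃ P, Θ'.P = Θ.P ++ P
  det : ∀ e u, Θ'.S e = some u → Θ.S e = none → e.IsTerm → Θ'.S.Det (D.F e u)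
  form : ∀ n, D.c n ∈ Θ'.S.dom → D.c n ∉ Θ.S.dom → .form n ∈ Θ'.S.dom

theorem Ext.refl (D : PosOp L) (Θ : Sequent L) : Ext D Θ Θ where
  le _ _ h := h
  P := ⟨[], by simp⟩
  det e u h h' := by simp [h] at h'
  form n h h' := (h' h).elim

theorem Ext.trans {D : PosOp L} {Θ Θ' Θ'' : Sequent L} (h : Ext D Θ Θ') (h' : Ext D Θ' Θ'') :
    Ext D Θ Θ'' where
  le e u he := h'.le e u (h.le e u he)
  P := by
    obtain ⟨P, hP⟩ := h.P
    obtain ⟨P', hP'⟩ := h'.P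
    exact ⟨P ++ P', by rw [hP', hP, List.append_assoc]⟩
  det e u he hn ht := by
    rcases hS : Θ'.S e with _ | w
    · exact h'.det e u he hS ht
    · have := h'.le e w hS
      rw [he] at this
      cases this
      exact (h.det e u hS hn ht).mono h'.le
  form n hn hn' := by
    by_cases hd : D.c n ∈ Θ'.S.dom
    · exact h'.le.dom (h.form n hd hn')
    · exact h'.form n hn hd

open Classical in
-- The obligations attached to the new pair `(e, u)` are demanded only of the final sequent `Θ'`.
-- The premise `Ψ` itself need not be an extension of `Θ` in the sense of `Ext`: the check of `F(e,
-- u)` is carried out above it.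
theorem Ext.of_update {D : PosOp L} {Θ Ψ Θ' : Sequent L} {e : CanExpr L} {u : Val}
    (hS : ∀ e', Ψ.S e' = if e' = e then some u else Θ.S e') (hP : Ψ.P = Θ.P)
    (he : e ∉ Θ.S.dom) (h : Ext D Ψ Θ') (hdet : e.IsTerm → Θ'.S.Det (D.F e u))
    (hform : ∀ n, e = D.c n → .form n ∈ Θ'.S.dom) : Ext D Θ Θ' where
  le e' w hw := h.le e' w (by
    rw [hS, if_neg, hw]
    rintro rfl
    exact he (by simp [Sub.dom, hw]))
  P := hP ▸ h.P
  det e' w hw hn ht := by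
    by_cases hee : e' = e
    · subst hee
      have := h.le e' u (by simp [hS])
      rw [hw] at this
      cases this
      exact hdet ht
    · exact h.det e' w hw (by rw [hS, if_neg hee, hn]) ht
  form n hn hn' := by
    by_cases hee : D.c n = e
    · exact hform n hee.symm
    · exact h.form n hn (by simpa [Sub.dom, hS, hee] using hn')

/-- `Θ` is derivable if all its extensions with the property `Q` are. -/
def Forces (D : PosOp L) {N : ℕ} (Cr : Fin (N + 1) → Critical L) (r : ℕ) (Θ : Sequent L)
    (Q : Sequent L → Prop) : Prop :=
  (∀ Θ', Ext D Θ Θ' → Reachable D Θ' → Q Θ' → CutDerivable D Cr r Θ') → CutDerivable D Cr r Θ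

/-- The uniformity in the starting sequent is what lets one goal be pursued above any sequent where
another has been reached. -/
def Forceable (D : PosOp L) {N : ℕ} (Cr : Fin (N + 1) → Critical L) (r : ℕ)
    (Q : Sequent L → Prop) : Prop :=
  ∀ Θ, Reachable D Θ → Forces D Cr r Θ Q

/-- A goal has to survive while later goals are being forced; see `Forceable.and`. -/
def Persistent (D : PosOp L) (Q : Sequent L → Prop) : Prop := ∀ Θ Θ', Ext D Θ Θ' → Q Θ → Q Θ'

variable {D : PosOp L} {N : ℕ} {Cr : Fin (N + 1) → Critical L} {r : ℕ}

/-- Composition of continuations. It needs no persistence of `Q`, since the second goal may depend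
on the sequent at which `Q` was reached. -/
theorem Forces.bind {Θ : Sequent L} {Q R : Sequent L → Prop} (h : Forces D Cr r Θ Q)
    (h' : ∀ Θ', Ext D Θ Θ' → Reachable D Θ' → Q Θ' → Forces D Cr r Θ' R) :
    Forces D Cr r Θ R :=
  fun k => h fun Θ' he hr hq => h' Θ' he hr hq fun Θ'' he' hr' hR => k Θ'' (he.trans he') hr' hR

theorem Forces.of_holds {Θ : Sequent L} {Q : Sequent L → Prop} (hr : Reachable D Θ) (h : Q Θ) :
    Forces D Cr r Θ Q := fun k => k Θ (Ext.refl D Θ) hr h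

theorem Forceable.imp {Q R : Sequent L → Prop} (h : Forceable D Cr r Q) (hi : ∀ Θ, Q Θ → R Θ) :
    Forceable D Cr r R :=
  fun Θ hr k => h Θ hr fun Θ' he hr' hq => k Θ' he hr' (hi Θ' hq)

theorem Forceable.and {Q R : Sequent L → Prop} (hQ : Forceable D Cr r Q)
    (hp : Persistent D Q) (hR : Forceable D Cr r R) :
    Forceable D Cr r fun Θ => Q Θ ∧ R Θ :=
  fun Θ hr => (hQ Θ hr).bind fun Θ' _ hr' hq k =>
    hR Θ' hr' fun Θ'' he' hr'' hR => k Θ'' he' hr'' ⟨hp _ _ he' hq, hR⟩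

theorem Forceable.forall_mem {α : Type*} {Q : α → Sequent L → Prop} (l : List α)
    (hQ : ∀ a ∈ l, Forceable D Cr r (Q a)) (hp : ∀ a, Persistent D (Q a)) :
    Forceable D Cr r fun Θ => ∀ a ∈ l, Q a Θ := by
  induction l with
  | nil => exact fun _ hr => Forces.of_holds hr (by simp)
  | cons a l ih =>
    exact ((hQ a (by simp)).and (hp a) (ih fun b hb => hQ b (by simp [hb]))).imp
      fun _ h => by simpa using h

theorem Forceable.forall_fin {k : ℕ} {Q : Fin k → Sequent L → Prop}
    (hQ : ∀ i, Forceable D Cr r (Q i)) (hp : ∀ i, Persistent D (Q i)) :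
    Forceable D Cr r fun Θ => ∀ i, Q i Θ :=
  (Forceable.forall_mem (List.finRange k) (fun i _ => hQ i) hp).imp fun _ h i =>
    h i (List.mem_finRange i)

theorem persistent_det (φ : Formula L 0) : Persistent D fun Θ => Θ.S.Det φ :=
  fun _ _ h hd => hd.mono h.le

theorem persistent_computes (t : Term L 0) : Persistent D fun Θ => Θ.S.Computes t :=
  fun _ _ h hd => (hd.mono h.le).1

theorem persistent_dom (e : CanExpr L) : Persistent D fun Θ => e ∈ Θ.S.dom :=
  fun _ _ h hd => h.le.dom hd

/-! Premises of `Cut` inferences. -/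

open Classical in
-- The value `⊤` is excluded because it would also require an entry in the sequence, and the last
-- hypothesis ensures that the new pair is entitled to a label.
theorem Reachable.addL {Θ : Sequent L} (h : Reachable D Θ) {e : CanExpr L} {u : Val}
    (hc : e.IsCanonical) (hf : e.Fits u) (he : e ∉ Θ.S.dom) (ht : u ≠ .tt)
    (hl : u = .unk ∨ D.rk e = Om) : Reachable D (Θ.addL e u false) := by
  obtain ⟨⟨h1, h2, h3, h4⟩, h5, h6⟩ := h
  refine ⟨⟨?_, h2, ?_, ?_⟩, ?_, h6⟩
  · intro e' w hw
    by_cases hee : e' = e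
    · subst hee
      simp only [Sequent.addL, Function.update_self] at hw
      cases hw
      exact ⟨hc, hf⟩
    · simp only [Sequent.addL, ne_eq, hee, not_false_eq_true, Function.update_of_ne] at hw
      exact h1 e' w hw
  · intro n
    by_cases hee : CanExpr.form n = e
    · subst hee
      simp only [Sequent.addL, Function.update_self, Option.some.injEq, ht, iff_false, h3]
      intro hs
      exact he (by simp [Sub.dom, hs])
    · simp only [Sequent.addL, Function.update_of_ne hee, h3]
  · intro e'
    by_cases hee : e' = e
    · subst hee
      simpa [Sequent.addL, PosOp.Labelled, Sub.dom] using hl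
    · simpa [Sequent.addL, PosOp.Labelled, Sub.dom, Function.update_of_ne hee] using h4 e'
  · intro e' b hb
    by_cases hee : e' = e
    · subst hee
      simp only [Sequent.addL, Function.update_self] at hb
      exact (Option.some.inj hb).symm
    · simp only [Sequent.addL, Function.update_of_ne hee] at hb
      exact h5 e' b hb

open Classical in
theorem Reachable.add {Θ : Sequent L} (h : Reachable D Θ) {e : CanExpr L} {m : ℕ}
    (hc : e.IsCanonical) (hf : e.Fits (.num m)) (he : e ∉ Θ.S.dom) (hr : D.rk e ≠ Om) :
    Reachable D (Θ.add e (.num m)) := by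
  obtain ⟨⟨h1, h2, h3, h4⟩, h5, h6⟩ := h
  refine ⟨⟨?_, h2, ?_, ?_⟩, h5, h6⟩
  · intro e' w hw
    by_cases hee : e' = e
    · subst hee
      simp only [Sequent.add, Function.update_self] at hw
      cases hw
      exact ⟨hc, hf⟩
    · simp only [Sequent.add, Function.update_of_ne hee] at hw
      exact h1 e' w hw
  · intro n
    have hee : CanExpr.form n ≠ e := by rintro rfl; exact hr rfl
    simp only [Sequent.add, Function.update_of_ne hee, h3]
  · intro e'
    by_cases hee : e' = e
    · subst hee
      have hn : ¬ (Θ.F e').isSome := by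
        rw [h4]
        rintro (h' | h')
        · exact he (by simp [Sub.dom, h'])
        · exact he h'.1
      simp only [Sequent.add, hn, PosOp.Labelled, Function.update_self, hr]
      simp
    · simpa [Sequent.add, PosOp.Labelled, Sub.dom, Function.update_of_ne hee] using h4 e'

theorem Reachable.addTop {Θ : Sequent L} (h : Reachable D Θ) {n : ℕ} {Pe : List ℕ}
    {Ve : ℕ → Option (Sub L)} (hp : D.Proper n Θ Pe) (hv : D.IsHistory Pe Ve) :
    Reachable D (Θ.addTop false Pe Ve) := by
  obtain ⟨⟨h1, ⟨h2, h2', h2''⟩, h3, h4⟩, h5, h6⟩ := h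
  obtain ⟨p1, -, p3, -, p5, p6⟩ := hp
  obtain ⟨v1, v2, v3⟩ := hv
  refine ⟨⟨?_, ⟨?_, ?_, ?_⟩, ?_, ?_⟩, ?_, p3⟩
  · intro e w hw
    simp only [Sequent.addTop] at hw
    split_ifs at hw with hm
    · obtain ⟨m, hm, rfl⟩ := hm
      cases hw
      exact ⟨trivial, trivial⟩
    · exact h1 e w hw
  · refine List.nodup_append.2 ⟨h2, p1, ?_⟩
    rintro a ha b hb rfl
    exact p5 a hb ha
  · intro m
    simp only [Sequent.addTop, List.mem_append]
    split_ifs with hm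
    · simp [hm, v2]
    · simp [hm, h2']
  · intro m T hT
    simp only [Sequent.addTop] at hT
    split_ifs at hT with hm
    · exact v3 m T hT
    · exact h2'' m T hT
  · intro m
    simp only [Sequent.addTop, List.mem_append, CanExpr.form.injEq, exists_eq_right']
    split_ifs with hm
    · simp [hm]
    · simp [hm, h3]
  · intro e
    simp only [Sequent.addTop, PosOp.Labelled, Sub.dom, Set.mem_ofPred_eq]
    split_ifs with hm
    · obtain ⟨m, hm, rfl⟩ := hm
      simp
    · exact h4 e
  · intro e b hb
    simp only [Sequent.addTop] at hb
    split_ifs at hb with hm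
    · exact (Option.some.inj hb).symm
    · exact h5 e b hb

-- Forcing domains, values of terms, and truth values of formulas

open Classical in
-- A single cut suffices, since `Ext` imposes no check on new formulas: either `n ∈ I` gets `?`, or
-- it is the last entry of the added history. Its rank `Ω` is below every bound considered.
theorem forceable_form (n : ℕ) : Forceable D Cr r fun Θ => .form n ∈ Θ.S.dom := by
  intro Θ hr
  by_cases hd : .form n ∈ Θ.S.dom
  · exact Forces.of_holds hr hd
  intro k
  refine CutDerivable.inf hr.isSequent (.cutOmForm n) (Om_le_bound r) hd ?_
  rintro Ψ (rfl | ⟨Pe, Ve, hp, hv, rfl⟩)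
  · refine k _ (Ext.of_update (Ψ := Θ.addL (.form n) .unk false) (e := .form n) (u := .unk) ?_ rfl
      hd (Ext.refl D _) False.elim
      fun m hm => by cases hm) (hr.addL trivial trivial hd (by simp) (Or.inl rfl)) ?_
    · intro e'; simp [Sequent.addL, Function.update_apply]
    · simp [Sequent.addL, Sub.dom]
  · refine k _ ⟨?_, ⟨Pe, rfl⟩, ?_, ?_⟩ (hr.addTop hp hv) ?_
    · intro e u he
      simp only [Sequent.addTop]
      rw [if_neg, he]
      rintro ⟨m, hm, rfl⟩
      exact hp.2.2.2.2.2 m hm (by simp [Sub.dom, he])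
    · intro e u he hn ht
      simp only [Sequent.addTop] at he
      rw [if_neg, hn] at he
      · cases he
      · rintro ⟨m, hm, rfl⟩; exact ht
    · intro m hm hm'
      exact (hm' (by simpa [Sequent.addTop, Sub.dom, PosOp.c] using hm)).elim
    · have : n ∈ Pe := List.mem_of_getLast? hp.2.2.2.1
      simp [Sequent.addTop, Sub.dom, this]

open Classical in
-- After the cut on `e`, each premise is continued by deciding `F(e, u)` and, when `e` is some
-- `c_n`, by settling `n ∈ I`. Only then is the result an extension of the conclusion.
theorem forceable_term {e : CanExpr L} (ht : e.IsTerm) (hc : e.IsCanonical)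
    (hrk : D.rk e ≤ Om + (r : Ordinal.{0}) + 1)
    (hF : ∀ u, Forceable D Cr r fun Θ => Θ.S.Det (D.F e (.num u))) :
    Forceable D Cr r fun Θ => e ∈ Θ.S.dom := by
  intro Θ hr
  by_cases hd : e ∈ Θ.S.dom
  · exact Forces.of_holds hr hd
  intro k
  have hF0 : ∀ S : Sub L, S.Det (D.F e .unk) := by
    cases e with
    | form n => exact ht.elim
    | term φ v => exact fun S => det_top S
  have hfits : e.Fits .unk ∧ ∀ u, 0 < u → e.Fits (.num u) := by
    cases e with
    | form n => exact ht.elim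
    | term φ v => exact ⟨trivial, fun u hu => hu⟩
  have hform : Forceable D Cr r fun Θ => ∀ n, e = D.c n → .form n ∈ Θ.S.dom := by
    by_cases h : ∃ n, e = D.c n
    · obtain ⟨n, rfl⟩ := h
      refine (forceable_form n).imp fun Θ' hn m hm => ?_
      have : n = m := by simpa [PosOp.c, funext_iff] using hm
      exact this ▸ hn
    · exact fun Θ' hr' => Forces.of_holds hr' fun n hn => (h ⟨n, hn⟩).elim
  -- The common treatment of all premises of both `Cut` rules for terms, whether the value is `?` or
  -- a numeral.
  have step : ∀ (Ψ : Sequent L) (u : Val),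
      (∀ e', Ψ.S e' = if e' = e then some u else Θ.S e') → Ψ.P = Θ.P → Reachable D Ψ →
      (Forceable D Cr r fun Θ => Θ.S.Det (D.F e u)) → CutDerivable D Cr r Ψ := by
    intro Ψ u hS hP hΨ hdet
    refine (hdet.and (persistent_det _) hform) Ψ hΨ fun Θ' hext hr' hq => ?_
    exact k Θ' (Ext.of_update hS hP hd hext (fun _ => hq.1) hq.2) hr'
      (hext.le.dom (by simp [Sub.dom, hS]))
  have hF1 : Forceable D Cr r fun Θ => Θ.S.Det (D.F e .unk) :=
    fun Θ' hr' => Forces.of_holds hr' (hF0 _)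
  by_cases hom : D.rk e = Om
  · refine CutDerivable.inf hr.isSequent (.cutOmTerm e) hrk ⟨hc, ht, hom, hd⟩ ?_
    rintro Ψ (rfl | ⟨u, hu, rfl⟩)
    · exact step _ .unk (fun e' => by simp [Sequent.addL, Function.update_apply]) rfl
        (hr.addL hc hfits.1 hd (by simp) (Or.inl rfl)) hF1
    · exact step _ (.num u) (fun e' => by simp [Sequent.addL, Function.update_apply]) rfl
        (hr.addL hc (hfits.2 u hu) hd (by simp) (Or.inr hom)) (hF u)
  · refine CutDerivable.inf hr.isSequent (.cut e) hrk ⟨hc, ht, hom, hd⟩ ?_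
    rintro Ψ (rfl | ⟨u, hu, rfl⟩)
    · exact step _ .unk (fun e' => by simp [Sequent.addL, Function.update_apply]) rfl
        (hr.addL hc hfits.1 hd (by simp) (Or.inl rfl)) hF1
    · exact step _ (.num u) (fun e' => by simp [Sequent.add, Function.update_apply]) rfl
        (hr.add hc (hfits.2 u hu) hd hom) (hF u)

/-- The arguments are computed first; only their values determine which canonical term must be cut.
That term has a name of rank below `q`, so its values can be checked by the induction hypothesis. -/
theorem forceable_computes {q : ℕ} (hq : q ≤ r)
    (ih : ∀ p < q, ∀ φ : Formula L 0, φ.WF → φ.rkS ≤ p → Forceable D Cr r fun Θ => Θ.S.Det φ)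
    {t : Term L 0} (hw : t.WF) (ht : t.rkS ≤ q) : Forceable D Cr r fun Θ => Θ.S.Computes t := by
  induction t using Term.ind with
  | var i => exact i.elim0
  | zero => exact fun Θ hr => Forces.of_holds hr rfl
  | succ t iht =>
    simp only [Term.WF, Term.rkS] at hw ht
    exact (iht hw ht).imp fun Θ h => computes_succ.2 h
  | func k f ts iht =>
    simp only [Term.WF, Term.rkS, Finset.sup_le_iff, Finset.mem_univ, true_imp_iff] at hw ht
    exact (Forceable.forall_fin (fun i => iht i (hw i) (ht i))
      fun i => persistent_computes _).imp fun Θ h => computes_func.2 h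
  | skol k φ ts iht =>
    simp only [Term.WF, Term.rkS, max_le_iff, Finset.sup_le_iff, Finset.mem_univ,
      true_imp_iff] at hw ht
    intro Θ hr
    refine ((Forceable.forall_fin (fun i => iht i (hw.2 i) (ht.2 i))
      fun i => persistent_computes _) Θ hr).bind fun Θ' _ hr' hts => ?_
    have := forceable_term (D := D) (Cr := Cr) (r := r)
      (e := .term φ fun i => (ts i).tv Θ'.S Fin.elim0) trivial hw.1
      (rk_term_le D _ (ht.1.trans hq)) fun u =>
        ih φ.rkS ht.1 _ (F_wf D hw.1.2 _ u) (F_rkS_le D φ _ u)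
    refine (this Θ' hr').bind fun Θ'' he hr'' hd => Forces.of_holds hr'' ?_
    have hm := fun i => (hts i).mono he.le
    refine computes_skol.2 ⟨fun i => (hm i).1, ?_⟩
    simpa only [fun i => (hm i).2] using hd

theorem forceable_det {φ : Formula L 0} (hw : φ.WF) (hr : φ.rkS ≤ r) :
    Forceable D Cr r fun Θ => Θ.S.Det φ := by
  -- The induction runs on an auxiliary bound `q`, while the bound `r` on the cuts stays fixed.
  suffices ∀ q ≤ r, ∀ φ : Formula L 0, φ.WF → φ.rkS ≤ q →
      Forceable D Cr r fun Θ => Θ.S.Det φ from this r le_rfl φ hw hr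
  intro q
  induction q using Nat.strong_induction_on with
  | _ q ih =>
    intro hq φ hw hφ
    have hc : ∀ t : Term L 0, t.WF → t.rkS ≤ q → Forceable D Cr r fun Θ => Θ.S.Computes t :=
      fun t => forceable_computes hq fun p hp => ih p hp (hp.le.trans hq)
    induction φ using Formula.ind with
    | top => exact fun Θ hr => Forces.of_holds hr (det_top _)
    | bot => exact fun Θ hr => Forces.of_holds hr (det_bot _)
    | eq s t =>
      simp only [Formula.WF, Formula.rkS, max_le_iff] at hw hφ
      exact ((hc s hw.1 hφ.1).and (persistent_computes s) (hc t hw.2 hφ.2)).imp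
        fun Θ h => det_eq.2 h
    | rel k R ts =>
      simp only [Formula.WF, Formula.rkS, Finset.sup_le_iff, Finset.mem_univ,
        true_imp_iff] at hw hφ
      exact (Forceable.forall_fin (fun i => hc _ (hw i) (hφ i))
        fun i => persistent_computes _).imp fun Θ h => det_rel.2 h
    | mem t =>
      simp only [Formula.WF, Formula.rkS] at hw hφ
      intro Θ hr
      refine (hc t hw hφ Θ hr).bind fun Θ' _ hr' ht => ?_
      refine (forceable_form (t.tv Θ'.S Fin.elim0) Θ' hr').bind fun Θ'' he hr'' hd =>
        Forces.of_holds hr'' ?_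
      have := ht.mono he.le
      exact det_mem.2 ⟨this.1, by rwa [this.2]⟩
    | neg φ ihφ =>
      simp only [Formula.WF, Formula.rkS] at hw hφ
      exact (ihφ hw hφ).imp fun Θ h => det_neg.2 h
    | and φ ψ ihφ ihψ =>
      simp only [Formula.WF, Formula.rkS, max_le_iff] at hw hφ
      exact ((ihφ hw.1 hφ.1).and (persistent_det _) (ihψ hw.2 hφ.2)).imp
        fun Θ h => det_and.2 h
    | or φ ψ ihφ ihψ =>
      simp only [Formula.WF, Formula.rkS, max_le_iff] at hw hφ
      exact ((ihφ hw.1 hφ.1).and (persistent_det _) (ihψ hw.2 hφ.2)).imp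
        fun Θ h => det_or.2 h

theorem forceable_canonical {k : ℕ} {φ : Formula L (k + 1)} (hφ : φ.Simple ∧ φ.WF)
    (v : Fin k → ℕ) (hr : φ.rkS + 1 ≤ r) :
    Forceable D Cr r fun Θ => CanExpr.term φ v ∈ Θ.S.dom :=
  forceable_term trivial hφ (rk_term_le D v hr) fun u => forceable_det (F_wf D hφ.2 v u)
    ((F_rkS_le D φ v u).trans ((Nat.le_succ _).trans hr))

/-- `forceable_canonical` does not apply when `r = 0`, as `c_n` has simple rank one. But its rank is
`Ω`, and `F(c_n, u)` has no Skolem functions, so no lower bound on `r` is needed. -/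
theorem forceable_c (n : ℕ) : Forceable D Cr r fun Θ => D.c n ∈ Θ.S.dom :=
  forceable_term trivial (c_canonical D) ((rk_c D n).trans_le (Om_le_bound r)) fun u =>
    forceable_det (F_wf D (c_canonical D).2 _ u)
      ((F_rkS_le D _ _ u).trans (by simp [Formula.rkS, D.noSkol.rkS]))

end Forcing

/-! The critical formulas. -/

theorem var_simple {n : ℕ} (i : Fin n) : (Term.var i : Term L n).Simple := trivial

theorem var_noSkol {n : ℕ} (i : Fin n) : (Term.var i : Term L n).NoSkol := trivial

theorem cons_simple {k n : ℕ} {t : Term L n} {s : Fin k → Term L n} (ht : t.Simple)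
    (hs : ∀ i, (s i).Simple) (i : Fin (k + 1)) :
    ((Fin.cons t s : Fin (k + 1) → Term L n) i).Simple := by
  induction i using Fin.cases with
  | zero => exact ht
  | succ i => exact hs i

theorem var_wf {n : ℕ} (i : Fin n) : (Term.var i : Term L n).WF := by simp [Term.WF]

theorem Bφ_simple_wf (D : PosOp L) {k : ℕ} {φ : Formula L (k + 1)} (h : φ.Simple ∧ φ.WF) :
    (D.Bφ φ).Simple ∧ (D.Bφ φ).WF := by
  constructor
  · exact Formula.plug_simple (fun t ht => h.1.subst (cons_simple ht fun i => var_simple _))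
      (D.simple.subst fun i => var_simple _)
  · exact Formula.plug_wf (fun t ht => h.2.subst (cons_wf ht fun i => var_wf _))
      (D.noSkol.wf.subst fun i => var_wf _)

/-- `B` is free of Skolem functions, so all those in `B(z, x, φ)` come from the copies of `φ`. -/
theorem Bφ_rkS_le (D : PosOp L) {k : ℕ} (φ : Formula L (k + 1)) : (D.Bφ φ).rkS ≤ φ.rkS :=
  Formula.plug_rkS_le (fun t ht => Formula.subst_rkS_le
    (cons_rkS_le (ht.rkS.le.trans (Nat.zero_le _)) fun i => by simp [Term.rkS]) le_rfl)
    (D.noSkol.subst fun i => var_noSkol _)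

theorem skol_wf {k n : ℕ} {φ : Formula L (k + 1)} (h : φ.Simple ∧ φ.WF) {s : Fin k → Term L n}
    (hs : ∀ i, (s i).WF) : (Term.skol φ s).WF := by
  simp only [Term.WF]; exact ⟨h, hs⟩

theorem neg_simple_wf {n : ℕ} {φ : Formula L n} (h : φ.Simple ∧ φ.WF) :
    φ.neg.Simple ∧ φ.neg.WF := by
  refine ⟨h.1, ?_⟩
  simp only [Formula.WF]; exact h.2

theorem imp_wf {n : ℕ} {φ ψ : Formula L n} (h : φ.WF) (h' : ψ.WF) : (φ.imp ψ).WF := by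
  simp [Formula.imp, Formula.WF, h, h']

theorem imp_simple_wf {n : ℕ} {φ ψ : Formula L n} (h : φ.Simple ∧ φ.WF) (h' : ψ.Simple ∧ ψ.WF) :
    (φ.imp ψ).Simple ∧ (φ.imp ψ).WF :=
  ⟨⟨h.1, h'.1⟩, imp_wf h.2 h'.2⟩

theorem exF_wf {k n : ℕ} {φ : Formula L (k + 1)} (h : φ.Simple ∧ φ.WF) {s : Fin k → Term L n}
    (hs : ∀ i, (s i).WF) : (exF φ s).WF :=
  h.2.subst (cons_wf (skol_wf h hs) hs)

theorem allF_wf {k n : ℕ} {φ : Formula L (k + 1)} (h : φ.Simple ∧ φ.WF) {s : Fin k → Term L n}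
    (hs : ∀ i, (s i).WF) : (allF φ s).WF :=
  h.2.subst (cons_wf (skol_wf (neg_simple_wf h) hs) hs)

theorem A_wf (D : PosOp L) {n : ℕ} {t : Term L n} (ht : t.WF) : (D.A t).WF :=
  allF_wf ⟨D.simple, D.noSkol.wf⟩ fun _ => ht

theorem Aφ_wf (D : PosOp L) {k n : ℕ} {φ : Formula L (k + 1)} (h : φ.Simple ∧ φ.WF)
    {s : Fin k → Term L n} (hs : ∀ i, (s i).WF) {t : Term L n} (ht : t.WF) : (D.Aφ φ s t).WF :=
  allF_wf (Bφ_simple_wf D h) (cons_wf ht hs)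

theorem Aφ_rkS_le (D : PosOp L) {k n r : ℕ} {φ : Formula L (k + 1)} (h : φ.rkS + 1 ≤ r)
    {s : Fin k → Term L n} (hs : ∀ i, (s i).rkS ≤ r) {t : Term L n} (ht : t.rkS ≤ r) :
    (D.Aφ φ s t).rkS ≤ r := by
  have hB := Bφ_rkS_le D φ
  refine Formula.subst_rkS_le (cons_rkS_le ?_ (cons_rkS_le ht hs)) (by omega)
  simp only [Term.rkS, Formula.rkS, max_le_iff, Finset.sup_le_iff, Finset.mem_univ, true_imp_iff]
  exact ⟨by omega, cons_rkS_le ht hs⟩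

theorem prog_simple_wf (D : PosOp L) {k : ℕ} {φ : Formula L (k + 1)} (h : φ.Simple ∧ φ.WF) :
    (D.prog φ).Simple ∧ (D.prog φ).WF := by
  refine imp_simple_wf ⟨?_, Aφ_wf D h (fun i => var_wf _) (var_wf _)⟩ h
  have hs := cons_simple (L := L) (k := k) (n := k + 1) (t := .var 0) (s := fun i => .var i.succ)
    trivial fun i => trivial
  -- The Skolem term in `A(x, φ)` has `x` as its first argument, hence is not closed, and simplicity
  -- is preserved.
  have ht : (Term.skol (D.Bφ φ).neg (Fin.cons (.var 0) fun i => .var i.succ) :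
      Term L (k + 1)).Simple := ⟨fun hc => hc 0, hs⟩
  exact (Bφ_simple_wf D h).1.subst (cons_simple ht hs)

theorem indStep_simple_wf {k : ℕ} {φ : Formula L (k + 1)} (h : φ.Simple ∧ φ.WF) :
    (indStep φ).Simple ∧ (indStep φ).WF := by
  refine ⟨⟨h.1, h.1.subst (cons_simple
    (show (Term.succ (.var 0) : Term L (k + 1)).Simple from trivial) fun i => var_simple _)⟩, ?_⟩
  simp only [indStep, Formula.WF]
  exact ⟨h.2, h.2.subst (cons_wf (by simp [Term.WF]) fun i => var_wf _)⟩

theorem predMatrix_simple_wf : (predMatrix : Formula L 2).Simple ∧ (predMatrix : Formula L 2).WF :=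
  ⟨⟨trivial, trivial⟩, by simp [predMatrix, Formula.WF, Term.WF]⟩

theorem mem_var_simple_wf {n : ℕ} (i : Fin n) :
    (Formula.mem (.var i) : Formula L n).Simple ∧ (Formula.mem (.var i) : Formula L n).WF :=
  ⟨trivial, by simp [Formula.WF, Term.WF]⟩

theorem Critical.WF.toFormula (D : PosOp L) {c : Critical L} (h : c.WF) : (c.toFormula D).WF := by
  cases c with
  | pred s =>
    refine imp_wf ?_ (exF_wf predMatrix_simple_wf fun _ => h)
    simp only [Formula.WF, Term.WF, and_true]
    exact h
  | eps φ s t => exact imp_wf (inst_wf h.1.2 h.2.1 h.2.2) (exF_wf h.1 h.2.1)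
  | ind φ s t =>
    refine imp_wf ?_ (exF_wf (indStep_simple_wf h.1) h.2.1)
    simp only [Formula.WF]
    exact ⟨inst_wf h.1.2 h.2.1 (by simp [Term.WF]), inst_wf h.1.2 h.2.1 h.2.2⟩
  | inddef t =>
    refine imp_wf (A_wf D h) ?_
    simp only [Formula.WF]
    exact h
  | closure φ s =>
    exact imp_wf (allF_wf (prog_simple_wf D h.1) h.2)
      (allF_wf (imp_simple_wf (mem_var_simple_wf 0) h.1) h.2)

theorem imp_rkS {n : ℕ} (φ ψ : Formula L n) : (φ.imp ψ).rkS = max φ.rkS ψ.rkS := by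
  simp [Formula.imp, Formula.rkS]

/-- The rank of `∃ x φ(x, s⃗)`, if `x` occurs in `φ`. -/
theorem rkS_of_occ {k n r : ℕ} {φ ψ : Formula L (k + 1)} {s : Fin k → Term L n} (hφ : φ.Occ 0)
    (h : (φ.subst (Fin.cons (.skol ψ s) s)).rkS ≤ r) : ψ.rkS + 1 ≤ r ∧ ∀ i, (s i).rkS ≤ r := by
  have := (hφ.rkS_le (σ := Fin.cons (.skol ψ s) s)).trans h
  simpa only [Fin.cons_zero, Term.rkS, max_le_iff, Finset.sup_le_iff, Finset.mem_univ,
    true_imp_iff] using this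

/-! Active expressions. -/

/-- The hypothesis is needed because for a formula `e` the step inserts `(e, ⊤)` regardless of `v`.
-/
theorem HS_self (D : PosOp L) (S : Sub L) (P : List ℕ) (V : ℕ → Option (Sub L)) {e : CanExpr L}
    {v : Val} (h : e.IsTerm ∨ v = .tt) : (e, v) ∈ D.HS S P V e v := by
  unfold PosOp.HS
  split_ifs with h1 h2 h3
  · exact Or.inr rfl
  · exact Or.inr rfl
  · exact Or.inr rfl
  · exact Or.inr (by rw [h.resolve_left h2]; rfl)

theorem active_self (D : PosOp L) {S : Sub L} {P : List ℕ} {V : ℕ → Option (Sub L)}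
    {e : CanExpr L} {v : Val} (he : S e = some .unk) (hv : v ≠ .unk) (h : e.IsTerm ∨ v = .tt) :
    D.Active S P V e v e :=
  ⟨by simp [Sub.dom, he], rfl, Or.inr ⟨v, HS_self D S P V h, by simpa [he] using hv.symm⟩⟩

/-- An `H`-step with expression `c_n` removes or changes `n ∈ I`. -/
theorem active_form {D : PosOp L} {S : Sub L} {P : List ℕ} {V : ℕ → Option (Sub L)} {n : ℕ}
    {v : Val} (hV : D.IsHistory P V) (hn : n ∈ P) (hS : S (.form n) = some .tt) :
    D.Active S P V (D.c n) v (.form n) := by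
  refine ⟨by simp [Sub.dom, hS], by simp, ?_⟩
  by_contra hno
  push Not at hno
  obtain ⟨⟨u, hu⟩, h2⟩ := hno
  have := h2 u hu
  rw [hS] at this
  cases this
  have hi : (D.c n).index = n := rfl
  have ht : (D.c n).IsTerm := trivial
  rw [PosOp.HS, if_neg (by simp), if_pos ht, hi, if_pos hn] at hu
  -- None of the sources of pairs can contribute `(n ∈ I, ⊤)`: the first has rank below `Ω`, the
  -- second stops before `n`, the stored `V(n ∈ I)` consists of negative pairs, and the last is the
  -- pair of `c_n`.
  rcases hu with ((h | h) | h) | h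
  · simp at h
  · rcases h with h | h
    · obtain ⟨m, -, hm⟩ := h.2
      cases hm
    · obtain ⟨m, hm, hm'⟩ := h.2
      cases hm'
      simpa using List.mem_takeWhile_imp hm
  · obtain ⟨T, hT⟩ := Option.isSome_iff_exists.1 ((hV.2.1 n).2 hn)
    rw [hT] at h
    have hneg := (hV.2.2 n T hT).2.2
    have h : T (.form n) = some .tt := h
    rw [← hneg] at h
    simp only [PosOp.negPart] at h
    split at h
    · split_ifs at h with hp
      cases h
      rcases hp with ⟨m, hm, -⟩ | ⟨m, -, hm⟩
      · cases hm
      · cases hm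
    · cases h
  · cases h

section Semantics

variable [L.Structure ℕ]

theorem tv_cons {k n : ℕ} (S : Sub L) (x : Fin n → ℕ) (t : Term L n) (s : Fin k → Term L n) :
    (fun i => ((Fin.cons t s : Fin (k + 1) → Term L n) i).tv S x) =
      (Fin.cons (t.tv S x) (fun i => (s i).tv S x) : Fin (k + 1) → ℕ) := by
  funext i
  induction i using Fin.cases with
  | zero => rfl
  | succ i => rfl

@[simp] theorem tv_inst {k n : ℕ} (S : Sub L) (x : Fin n → ℕ) (φ : Formula L (k + 1))
    (s : Fin k → Term L n) (t : Term L n) :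
    (inst φ s t).tv S x ↔
      φ.tv S (Fin.cons (t.tv S x) (fun i => (s i).tv S x) : Fin (k + 1) → ℕ) := by
  rw [inst, Formula.tv_subst, tv_cons]

@[simp] theorem tv_exF {k n : ℕ} (S : Sub L) (x : Fin n → ℕ) (φ : Formula L (k + 1))
    (s : Fin k → Term L n) :
    (exF φ s).tv S x ↔ φ.tv S (Fin.cons ((Term.skol φ s).tv S x) (fun i => (s i).tv S x) :
      Fin (k + 1) → ℕ) := tv_inst S x φ s _

@[simp] theorem tv_allF {k n : ℕ} (S : Sub L) (x : Fin n → ℕ) (φ : Formula L (k + 1))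
    (s : Fin k → Term L n) :
    (allF φ s).tv S x ↔ φ.tv S (Fin.cons ((Term.skol φ.neg s).tv S x) (fun i => (s i).tv S x) :
      Fin (k + 1) → ℕ) := tv_inst S x φ s _

theorem tv_skol_num {k n : ℕ} {S : Sub L} {x : Fin n → ℕ} {φ : Formula L (k + 1)}
    {s : Fin k → Term L n} {u : ℕ}
    (h : S (.term φ fun i => (s i).tv S x) = some (.num u)) : (Term.skol φ s).tv S x = u := by
  simp only [Term.tv, h]

@[simp] theorem tv_instNum {k : ℕ} (S : Sub L) (φ : Formula L (k + 1)) (v : Fin k → ℕ) (u : ℕ) :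
    (instNum φ v u).tv S Fin.elim0 ↔ φ.tv S (Fin.cons u v : Fin (k + 1) → ℕ) := by
  simp [instNum]

theorem tv_prog (D : PosOp L) {k n : ℕ} (S : Sub L) (x : Fin n → ℕ) (φ : Formula L (k + 1))
    (s : Fin k → Term L n) (a : ℕ) :
    (D.prog φ).tv S (Fin.cons a (fun i => (s i).tv S x) : Fin (k + 1) → ℕ) ↔
      ((D.Aφ φ s (numeral a)).tv S x → (inst φ s (numeral a)).tv S x) := by
  have h : ∀ y : Fin (k + 1) → ℕ,
      (fun i => ((Fin.cons (.var 0) fun i => .var i.succ :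
        Fin (k + 1) → Term L (k + 1)) i).tv S y) = y := by
    intro y
    funext i
    induction i using Fin.cases with
    | zero => rfl
    | succ i => rfl
  rw [PosOp.prog, tv_imp, PosOp.Aφ, PosOp.Aφ, tv_allF, tv_allF, tv_inst, tv_numeral, h, tv_cons,
    tv_numeral]
  simp only [Term.tv, h, fun i => congrFun (tv_cons S x (numeral a) s) i, tv_numeral]

theorem inst_computes {k : ℕ} {S : Sub L} {φ : Formula L (k + 1)} {s : Fin k → Term L 0}
    {t : Term L 0} (hφ : φ.Occ 0) (h : S.Det (inst φ s t)) : S.Computes t :=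
  hφ.computes h

/-! Correctness. -/

/-- Numerical values of terms were checked when they were introduced: `F(e, u)` is decided and not
refuted. The values `⊤` were never checked by cuts; for them admissibility of the sequence replaces
the check. -/
theorem correct_of_not_CI {D : PosOp L} {Θ : Sequent L} (hr : Reachable D Θ)
    (he : Ext D Sequent.empty Θ) (hci : ¬ D.CI Θ.S) : D.Correct Θ.S := by
  obtain ⟨⟨hS, hH, hP, -⟩, -, hadm⟩ := hr
  intro e u h
  have hf := hS e u h
  cases e with
  | term φ v =>
    cases u with
    | unk => exact Sub.sat_iff.2 ⟨det_top _, trivial⟩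
    | tt => exact hf.2.elim
    | num u =>
      have hd := he.det _ _ h rfl trivial
      have hn : ¬ Θ.S.Sat (D.F (.term φ v) (.num u)).neg := fun h' => hci (Or.inl ⟨_, _, h, h'⟩)
      rw [Sub.sat_iff, det_neg] at hn
      rw [(F_wf D hf.1.2 v u).sat_bar]
      by_contra h'
      exact hn ⟨hd, h'⟩
  | form n =>
    cases u with
    | unk => exact Sub.sat_iff.2 ⟨det_top _, trivial⟩
    | num u => exact hf.2.elim
    | tt =>
      change Θ.S.bar.Sat (D.A (numeral n))
      rw [(A_wf D (numeral_wf n)).sat_bar, PosOp.A, tv_allF]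
      -- By the second clause of computational inconsistency `c_n` has no numerical value, so it is
      -- read as `0`, which is the instance of `B` in the definition of admissibility.
      have h0 : (Term.skol D.B.neg fun _ : Fin 1 => (numeral n : Term L 0)).tv Θ.S Fin.elim0 = 0 := by
        simp only [Term.tv, tv_numeral]
        rcases hc : Θ.S (.term D.B.neg fun _ : Fin 1 => n) with _ | w
        · rfl
        · cases w with
          | unk => rfl
          | tt => rfl
          | num w => exact (hci (Or.inr ⟨n, _, hc, by simp, h⟩)).elim
      obtain ⟨l, l', hl⟩ := List.append_of_mem ((hP n).2 h)
      have hB := hadm l n l' hl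
      rw [(D.noSkol.wf.subst (by
        intro i
        induction i using Fin.cases with
        | zero => exact numeral_wf 0
        | succ i => fin_cases i; exact numeral_wf n)).sat_bar, Formula.tv_subst] at hB
      have hx : (fun i => ((![numeral 0, numeral n] : Fin 2 → Term L 0) i).tv (topSub l : Sub L)
          Fin.elim0) = (Fin.cons 0 (fun _ => n) : Fin 2 → ℕ) := by
        funext i
        fin_cases i <;> simp
      rw [hx] at hB
      simp only [h0, tv_numeral]
      -- Admissibility gives `B(0, n, ·)` for the entries before `n`; by positivity it persists for
      -- the whole interpretation of `I` in `Θ`.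
      refine (Formula.tv_mono (fun m hm => ?_) D.noSkol).1 D.pos hB
      simp only [topSub] at hm
      split_ifs at hm with hml
      exact (hP m).1 (by rw [hl]; simp [hml])

theorem Correct.tv_of_num {D : PosOp L} {S : Sub L} (hS : S.IsSub) (hc : D.Correct S) {k : ℕ}
    {φ : Formula L (k + 1)} {v : Fin k → ℕ} {u : ℕ} (h : S (.term φ v) = some (.num u)) :
    φ.tv S (Fin.cons u v : Fin (k + 1) → ℕ) := by
  have := hc _ _ h
  rw [(F_wf D (hS _ _ h).1.2 v u).sat_bar] at this
  exact (tv_instNum S φ v u).1 this.1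

/-- A false Skolem axiom instance has the default value for its Skolem term. -/
theorem eq_unk_of_not_exF {D : PosOp L} {S : Sub L} (hS : S.IsSub) (hc : D.Correct S) {k : ℕ}
    {φ : Formula L (k + 1)} {s : Fin k → Term L 0}
    (hd : CanExpr.term φ (fun i => (s i).tv S Fin.elim0) ∈ S.dom)
    (h : ¬ φ.tv S (Fin.cons ((Term.skol φ s).tv S Fin.elim0) (fun i => (s i).tv S Fin.elim0) :
      Fin (k + 1) → ℕ)) :
    S (.term φ fun i => (s i).tv S Fin.elim0) = some .unk := by
  obtain ⟨u, hu⟩ := Option.isSome_iff_exists.1 hd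
  cases u with
  | unk => exact hu
  | tt => exact (hS _ _ hu).2.elim
  | num u =>
    rw [tv_skol_num hu] at h
    exact (h (Correct.tv_of_num hS hc hu)).elim

-- Preparing and repairing the critical formulas

/-- What has to be forced, for the `H`-step, after a critical formula has been decided in `Θ₀`. -/
def Prepared (D : PosOp L) (Θ₀ Θ : Sequent L) : Critical L → Prop
  | .pred _ => True
  | .eps _ _ _ => True
  | .ind φ s t => φ.Occ 0 → ∀ m ∈ List.range (t.tv Θ₀.S Fin.elim0 + 1),
      Θ.S.Det (inst φ s (numeral m))
  | .inddef t => D.c (t.tv Θ₀.S Fin.elim0) ∈ Θ.S.dom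
  | .closure φ s => ∀ m ∈ Θ₀.P, Θ.S.Det (inst φ s (numeral m)) ∧
      Θ.S.Det (D.Aφ φ s (numeral m)) ∧
      (CanExpr.term (D.Bφ φ).neg (Fin.cons m fun i => (s i).tv Θ₀.S Fin.elim0) ∈ Θ.S.dom ∧
      D.c m ∈ Θ.S.dom)

theorem persistent_prepared (D : PosOp L) (Θ₀ : Sequent L) (c : Critical L) :
    Persistent D fun Θ => Prepared D Θ₀ Θ c := by
  intro Θ Θ' h hp
  cases c with
  | pred s => trivial
  | eps φ s t => trivial
  | ind φ s t => exact fun ho m hm => (hp ho m hm).mono h.le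
  | inddef t => exact h.le.dom hp
  | closure φ s =>
    intro m hm
    obtain ⟨h1, h2, h3, h4⟩ := hp m hm
    exact ⟨h1.mono h.le, h2.mono h.le, h.le.dom h3, h.le.dom h4⟩

/-- The ranks stay below `r` because the Skolem term of the conclusion of the critical formula
already bounds the rank of the matrix and of the parameters. -/
theorem forceable_prepared {D : PosOp L} {N : ℕ} {Cr : Fin (N + 1) → Critical L} {r : ℕ}
    (Θ₀ : Sequent L) {c : Critical L} (hw : c.WF) (hr : (c.toFormula D).rkS ≤ r) :
    Forceable D Cr r fun Θ => Prepared D Θ₀ Θ c := by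
  cases c with
  | pred s => exact fun Θ h => Forces.of_holds h trivial
  | eps φ s t => exact fun Θ h => Forces.of_holds h trivial
  | ind φ s t =>
    -- If `x` does not occur in `φ`, the Skolem term is absent and gives no rank bound; but then the
    -- critical formula cannot fail and nothing has to be prepared.
    by_cases ho : φ.Occ 0
    · simp only [Critical.toFormula, imp_rkS, max_le_iff] at hr
      obtain ⟨h1, h2⟩ := rkS_of_occ (φ := indStep φ) (Or.inl ho) hr.2
      have h3 : φ.rkS ≤ r := by
        simp only [indStep, Formula.rkS] at h1
        omega
      refine (Forceable.forall_mem (List.range _) (fun m _ => forceable_det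
        (inst_wf hw.1.2 hw.2.1 (numeral_wf m)) (inst_rkS_le h3 h2 (by simp)))
        fun m => persistent_det _).imp fun Θ h _ => h
    · exact fun Θ h => Forces.of_holds h fun ho' => (ho ho').elim
  | inddef t => exact forceable_c _
  | closure φ s =>
    simp only [Critical.toFormula, imp_rkS, max_le_iff] at hr
    -- Here no case distinction is needed: the matrix `x ∈ I → φ(x)` always contains `x`.
    obtain ⟨h1, h2⟩ := rkS_of_occ (φ := (Formula.mem (.var 0)).imp φ)
      (show Formula.Occ 0 ((Formula.mem (.var 0)).imp φ) from Or.inl rfl) hr.2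
    simp only [Formula.rkS, imp_rkS] at h1
    have h3 : φ.rkS + 1 ≤ r := by omega
    have h4 := Bφ_rkS_le D φ
    refine Forceable.forall_mem Θ₀.P (fun m _ => ?_) fun m Θ Θ' h hp =>
      ⟨hp.1.mono h.le, hp.2.1.mono h.le, h.le.dom hp.2.2.1, h.le.dom hp.2.2.2⟩
    refine (forceable_det (inst_wf hw.1.2 hw.2 (numeral_wf m))
      (inst_rkS_le (by omega) h2 (by simp))).and (persistent_det _) ?_
    refine (forceable_det (Aφ_wf D hw.1 hw.2 (numeral_wf m))
      (Aφ_rkS_le D h3 h2 (by simp))).and (persistent_det _) ?_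
    refine (forceable_canonical (neg_simple_wf (Bφ_simple_wf D hw.1)) _ ?_).and
      (persistent_dom _) (forceable_c m)
    simp only [Formula.rkS]
    omega

open Classical in
/-- In a prepared sequent, all calculations for a failing critical formula take place in the
sequent itself, and the repair changes an expression with a label. -/
theorem repair_active {D : PosOp L} {Θ₀ Θ : Sequent L} (hr₀ : Reachable D Θ₀)
    (hr : Reachable D Θ) (hext : Ext D Θ₀ Θ) (hc : D.Correct Θ.S) (hci : ¬ D.CI Θ.S)
    {c : Critical L} (hw : c.WF) (hd : Θ₀.S.Det (c.toFormula D)) (hp : Prepared D Θ₀ Θ c)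
    (hfail : ¬ Θ.S.bar.Sat (c.toFormula D)) :
    D.RepairComputed Θ.S Θ.P c ∧ Θ.S (D.repair Θ.S Θ.P c).1 = some .unk ∧
      (∀ n, (D.repair Θ.S Θ.P c).1 = .form n → D.c n ∈ Θ.S.dom) ∧
      ∃ e', D.Active Θ.S Θ.P Θ.V (D.repair Θ.S Θ.P c).1 (D.repair Θ.S Θ.P c).2 e' ∧
        D.Labelled Θ.S e' := by
  have hS := hr.isSequent.1
  rw [(hw.toFormula D).sat_bar] at hfail
  have hd' := hd.mono hext.le
  have self : ∀ {e : CanExpr L} {v : Val}, Θ.S e = some .unk → v ≠ .unk → e.IsTerm →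
      Θ.S e = some .unk ∧ (∀ n, e = .form n → D.c n ∈ Θ.S.dom) ∧
      ∃ e', D.Active Θ.S Θ.P Θ.V e v e' ∧ D.Labelled Θ.S e' :=
    fun {e v} h hv ht => ⟨h, fun n hn => by rw [hn] at ht; exact ht.elim,
      e, active_self D h hv (Or.inl ht), Or.inl h⟩
  cases c with
  | pred s =>
    simp only [Critical.toFormula, tv_imp, tv_exF, det_imp] at hfail hd'
    push Not at hfail
    have hcs := computes_skol.1 (Formula.Occ.computes (φ := predMatrix) (j := 0)
      (show (predMatrix : Formula L 2).Occ 0 from Or.inr rfl) hd'.2)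
    refine ⟨hcs.1 0, ?_⟩
    simp only [PosOp.repair, Term.WF.ev_eq hw]
    exact self (eq_unk_of_not_exF hS hc hcs.2 hfail.2) (by simp) trivial
  | eps φ s t =>
    simp only [Critical.toFormula, tv_imp, tv_exF, det_imp, tv_inst] at hfail hd'
    push Not at hfail
    -- With a vacuous variable `φ(t)` and `∃ x φ(x)` have the same truth value, so the formula could
    -- not fail.
    have ho : φ.Occ 0 := by
      by_contra ho
      exact hfail.2 ((Formula.tv_cons_congr ho _ _ _).1 hfail.1)
    have hcs := computes_skol.1 (Formula.Occ.computes (φ := φ) (j := 0) ho hd'.2)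
    refine ⟨⟨hcs.1, inst_computes ho hd'.1⟩, ?_⟩
    simp only [PosOp.repair, fun i => Term.WF.ev_eq (S := Θ.S) (hw.2.1 i)]
    exact self (eq_unk_of_not_exF hS hc hcs.2 hfail.2) (by simp) trivial
  | ind φ s t =>
    simp only [Critical.toFormula, tv_imp, tv_exF, det_imp, Formula.tv, tv_inst] at hfail hd'
    push Not at hfail
    have ho : φ.Occ 0 := by
      by_contra ho
      exact hfail.1.2 ((Formula.tv_cons_congr ho _ _ _).1 hfail.1.1)
    have hcs := computes_skol.1 (Formula.Occ.computes (φ := indStep φ) (j := 0)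
      (Or.inl ho) hd'.2)
    have ht := inst_computes ho (det_neg.1 (det_and.1 hd'.1).2)
    -- The term `t` was already computed in `Θ₀`, so the range of instances prepared there is the
    -- one needed in `Θ`.
    have ht₀ := inst_computes ho (det_neg.1 (det_and.1 (det_imp.1 hd).1).2)
    refine ⟨⟨hcs.1, ht, fun m hm => ?_⟩, ?_⟩
    · rw [Term.WF.ev_eq hw.2.2, (ht₀.mono hext.le).2] at hm
      exact Sub.decides_iff.2 (hp ho m (List.mem_range.2 (Nat.lt_succ_of_le hm)))
    · simp only [PosOp.repair, fun i => Term.WF.ev_eq (S := Θ.S) (hw.2.1 i)]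
      exact self (eq_unk_of_not_exF hS hc hcs.2 hfail.2) (by simp) trivial
  | inddef t =>
    simp only [Critical.toFormula, tv_imp, det_imp, Formula.tv] at hfail hd'
    push Not at hfail
    obtain ⟨ht, hdom⟩ := det_mem.1 hd'.2
    refine ⟨ht, ?_⟩
    simp only [PosOp.repair, Term.WF.ev_eq (S := Θ.S) hw]
    have hu : Θ.S (.form (t.tv Θ.S Fin.elim0)) = some .unk := by
      obtain ⟨u, hu⟩ := Option.isSome_iff_exists.1 hdom
      cases u with
      | unk => exact hu
      | tt => exact (hfail.2 hu).elim
      | num u => exact (hS _ _ hu).2.elim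
    refine ⟨hu, ?_, _, active_self D hu (by simp) (Or.inr rfl), Or.inl hu⟩
    intro n hn
    cases hn
    rw [((det_mem.1 (det_imp.1 hd).2).1.mono hext.le).2]
    exact hp
  | closure φ s =>
    have hd₀ := hd
    simp only [Critical.toFormula, tv_imp, tv_allF, det_imp] at hfail hd' hd₀
    push Not at hfail
    obtain ⟨hprog, hmem, hφ⟩ := hfail
    set σ : Term L 0 := .skol ((Formula.mem (.var 0)).imp φ).neg s with hσ
    set d := σ.tv Θ.S Fin.elim0 with hd_def
    have hσ₀ := det_mem.1 (det_imp.1 hd₀.2).1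
    change Θ₀.S.Computes σ ∧ _ at hσ₀
    have hσd := (hσ₀.1.mono hext.le).2
    have hs : ∀ i, Θ.S.Computes (s i) ∧ (s i).tv Θ.S Fin.elim0 = (s i).tv Θ₀.S Fin.elim0 :=
      fun i => ((computes_skol.1 hσ₀.1).1 i).mono hext.le
    -- The witness `d` of failure satisfies `d ∈ I`, and this atom was decided in `Θ₀`. Hence `d`
    -- was in the sequence before the preparation, and later entries cannot matter.
    have hdP : d ∈ Θ₀.P := by
      rw [hr₀.isSequent.2.2.1]
      obtain ⟨u, hu⟩ := Option.isSome_iff_exists.1 hσ₀.2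
      change Θ₀.S (.form (σ.tv Θ₀.S Fin.elim0)) = some u at hu
      rw [← hσd] at hu
      have h1 : Θ.S (.form d) = some .tt := hmem
      have h2 := hext.le _ _ hu
      rw [hd_def, h2] at h1
      cases h1
      exact hu
    have hsat : ∀ m, Θ.S.bar.Sat (inst φ s (numeral m)).neg ↔
        ¬ φ.tv Θ.S (Fin.cons m fun i => (s i).tv Θ.S Fin.elim0 : Fin _ → ℕ) := by
      intro m
      rw [Formula.WF.sat_bar (by
        simp only [Formula.WF]; exact inst_wf hw.1.2 hw.2 (numeral_wf m))]
      simp [Formula.tv]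
    obtain ⟨n, hn⟩ : ∃ n, firstFail Θ.S Θ₀.P φ s = some n := by
      rw [← Option.isSome_iff_exists]
      unfold firstFail
      rw [List.find?_isSome]
      exact ⟨d, hdP, by simpa [hsat] using hφ⟩
    obtain ⟨hfn, as, bs, hP₀, -⟩ := List.find?_eq_some_iff_append.1 hn
    rw [decide_eq_true_iff, hsat] at hfn
    obtain ⟨P₁, hP₁⟩ := hext.P
    -- The sequence of `Θ` only appends to that of `Θ₀`, so the first failing entry is unchanged.
    have hn' : firstFail Θ.S Θ.P φ s = some n := by
      unfold firstFail at hn ⊢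
      rw [hP₁, List.find?_append, hn]
      rfl
    have hnP : n ∈ Θ₀.P := by rw [hP₀]; simp
    have hnP' : n ∈ Θ.P := by rw [hP₁]; simp [hnP]
    have htt := (hr.isSequent.2.2.1 n).1 hnP'
    obtain ⟨-, hA, hB, hcn⟩ := hp n hnP
    have hev : (fun i => Θ.S.ev (s i)) = fun i => (s i).tv Θ.S Fin.elim0 :=
      funext fun i => Term.WF.ev_eq (hw.2 i)
    have hAw : (D.Aφ φ s (numeral n)).neg.WF := by
      simp only [Formula.WF]; exact Aφ_wf D hw.1 hw.2 (numeral_wf n)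
    refine ⟨⟨fun i => (hs i).1, as, n, bs ++ P₁, by rw [hP₁, hP₀]; simp, hn', ?_, ?_, ?_⟩, ?_⟩
    · intro m hm
      refine Sub.decides_iff.2 (hp m ?_).1
      rw [hP₀]
      simp only [List.mem_append, List.mem_cons, List.not_mem_nil, or_false] at hm ⊢
      tauto
    · exact Sub.decides_iff.2 hA
    · intro _
      rw [hev]
      simpa only [fun i => (hs i).2] using hB
    · simp only [PosOp.repair, hn', Option.getD_some]
      split_ifs with hAn
      -- The active expression is `n ∈ I` and not `c_n`: the `H`-value is the value of another
      -- Skolem term, which may be `?`, and then `c_n` itself would not change. Being of rank `Ω`,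
      -- `n ∈ I` carries a label even with value `⊤`.
      · refine ⟨?_, fun m hm => (by cases hm), .form n,
          active_form hr.isSequent.2.1 hnP' htt, Or.inr ⟨by simp [Sub.dom, htt], rfl⟩⟩
        obtain ⟨u, hu⟩ := Option.isSome_iff_exists.1 hcn
        -- A value of `c_n` other than `?` would clash with `(n ∈ I, ⊤)`.
        by_cases huu : u = .unk
        · exact huu ▸ hu
        · exact (hci (Or.inr ⟨n, u, hu, huu, htt⟩)).elim
      -- Now `A(n, φ)` holds and `φ(n)` fails, so progressivity fails at `n` although it holds at
      -- the value of its Skolem term. Correctness then forbids a numerical value for that term.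
      · rw [hAw.sat_bar] at hAn
        simp only [Formula.tv, not_not] at hAn
        have hfalse : ¬ (D.prog φ).tv Θ.S
            (Fin.cons n fun i => (s i).tv Θ.S Fin.elim0 : Fin _ → ℕ) := by
          rw [tv_prog]
          intro h
          exact hfn (by simpa using h hAn)
        have ho : (D.prog φ).Occ 0 := by
          by_contra ho
          exact hfalse ((Formula.tv_cons_congr ho _ _ _).1 hprog)
        have hcs := computes_skol.1 (Formula.Occ.computes (φ := D.prog φ) (j := 0) ho hd'.1)
        rw [hev]
        suffices hu : Θ.S (.term (D.prog φ).neg fun i => (s i).tv Θ.S Fin.elim0) = some .unk from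
          have h := self (v := .num n) hu (by simp) trivial
          ⟨h.1, fun _ h' => h'.elim, h.2.2⟩
        obtain ⟨u, hu⟩ := Option.isSome_iff_exists.1 hcs.2
        cases u with
        | unk => exact hu
        | tt => exact (hS _ _ hu).2.elim
        | num u =>
          rw [tv_skol_num hu] at hprog
          exact (Correct.tv_of_num hS hc hu hprog).elim

-- Leaves are axioms, and the assembly of the derivation

theorem exists_HIndex {D : PosOp L} {N : ℕ} {Cr : Fin (N + 1) → Critical L} {S : Sub L}
    (P : List ℕ) (h : ¬ D.Solving Cr S) : ∃ i, D.IsHIndex Cr S P i := by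
  classical
  unfold PosOp.Solving at h
  push Not at h
  obtain ⟨i, hi, hmin⟩ := Finset.exists_min_image
    (Finset.univ.filter fun i => ¬ S.bar.Sat ((Cr i).toFormula D))
    (fun i => toLex (D.rk (D.repair S P (Cr i)).1, i)) (by
      obtain ⟨i, hi⟩ := h
      exact ⟨i, by simpa using hi⟩)
  simp only [Finset.mem_filter, Finset.mem_univ, true_and, Prod.Lex.toLex_le_toLex] at hi hmin
  refine ⟨i, hi, fun j hj => ?_⟩
  rcases hmin j hj with hlt | ⟨heq, hle⟩
  · exact ⟨hlt.le, fun h' => (hlt.ne' h').elim⟩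
  · exact ⟨heq.le, fun _ => hle⟩

theorem isAxiom_of_prepared {D : PosOp L} {N : ℕ} {Cr : Fin (N + 1) → Critical L}
    (hCr : ∀ i, (Cr i).WF) {Θ₀ Θ : Sequent L} (hr₀ : Reachable D Θ₀) (hr : Reachable D Θ)
    (h₀ : Ext D Sequent.empty Θ₀) (hext : Ext D Θ₀ Θ)
    (hd : ∀ i, Θ₀.S.Det ((Cr i).toFormula D)) (hp : ∀ i, Prepared D Θ₀ Θ (Cr i)) :
    D.IsAxiom Cr Θ := by
  by_cases hci : D.CI Θ.S
  · exact Or.inl hci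
  by_cases hsol : D.Solving Cr Θ.S
  · exact Or.inr (Or.inl hsol)
  -- Relative to the empty sequent every pair is new, so the clauses of `Ext` hold for all of `Θ`.
  have hE := h₀.trans hext
  have hc := correct_of_not_CI hr hE hci
  have key := fun i hf => repair_active hr₀ hr hext hc hci (hCr i) (hd i) (hp i) hf
  obtain ⟨i, hi⟩ := exists_HIndex (Cr := Cr) Θ.P hsol
  obtain ⟨-, hunk, hform, e', hact, hlab⟩ := key i hi.1
  have hdom : ∀ n, D.c n ∈ Θ.S.dom → .form n ∈ Θ.S.dom := fun n hn =>
    hE.form n hn (by simp [Sequent.empty, Sub.dom])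
  refine Or.inr (Or.inr ⟨_, _, ⟨hc, hsol, fun j => Sub.decides_iff.2 ((hd j).mono hext.le),
    fun j hj => (key j hj).1, ⟨i, hi, rfl⟩, hunk, fun n hn => hdom n ?_, hform,
    fun _ _ m hm => hdom m (by simp [Sub.dom, hm])⟩, e', hact, ?_⟩)
  · rw [← hn]; exact Option.isSome_iff_exists.2 ⟨_, hunk⟩
  · obtain ⟨b, hb⟩ := Option.isSome_iff_exists.1 ((hr.isSequent.2.2.2 e').2 hlab)
    rw [hb, hr.label e' b hb]

theorem reachable_empty (D : PosOp L) : Reachable D Sequent.empty := by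
  refine ⟨⟨?_, ⟨?_, ?_, ?_⟩, ?_, ?_⟩, ?_, ?_⟩ <;>
    simp [Sequent.empty, Sub.IsSub, PosOp.Labelled, Sub.dom, PosOp.Admissible]

/-- For the empty sequent the set of ranks is finite, as there are no formulas `F(e, u)`.
Boundedness has to be shown, since the supremum of an unbounded set of naturals is the default `0`.
-/
theorem le_rho_empty (D : PosOp L) {N : ℕ} (Cr : Fin (N + 1) → Critical L) (i : Fin (N + 1)) :
    ((Cr i).toFormula D).rkS ≤
      D.rho Sequent.empty (Set.range fun i => (Cr i).toFormula D) := by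
  refine (Formula.rkS_le_red_empty _).trans (le_csSup ?_ ?_)
  · refine Set.Finite.bddAbove ((Set.finite_range fun i : Fin (N + 1) =>
      (((Cr i).toFormula D).red fun _ => none).rkS).subset ?_)
    rintro m ⟨φ, ⟨i, rfl⟩ | ⟨e, u, he, -⟩, rfl⟩
    · exact ⟨i, rfl⟩
    · cases he
  · exact ⟨_, Or.inl ⟨i, rfl⟩, rfl⟩

end Semantics

end EpsID1

end

theorem mainTheorem6 (L : FirstOrder.Language.{0, 0}) [L.Structure ℕ] (D : EpsID1.PosOp L)
    (N : ℕ) (Cr : Fin (N + 1) → EpsID1.Critical L) (hCr : ∀ i, (Cr i).WF) :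
    ∃ d : EpsID1.Derivation D Cr EpsID1.Sequent.empty,
      d.AllRules (D.IsCutLE
        (EpsID1.Om + ((D.rho EpsID1.Sequent.empty
          (Set.range fun i => (Cr i).toFormula D) : ℕ) : Ordinal.{0}) + 1)) := by
  have hr := EpsID1.le_rho_empty D Cr
  -- First round: decide all critical formulas. The resulting `Θ₀` fixes the values of their
  -- parameters and the part of the sequence relevant for Closure.
  refine EpsID1.Forceable.forall_fin
    (fun i => EpsID1.forceable_det ((hCr i).toFormula D) (hr i))
    (fun i => EpsID1.persistent_det _) _ (EpsID1.reachable_empty D) fun Θ₀ h₀ hr₀ hd => ?_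
  -- Second round, with `Θ₀` as a fixed reference, so that the list of demands is finite and does
  -- not grow with the sequence.
  refine EpsID1.Forceable.forall_fin
    (fun i => EpsID1.forceable_prepared Θ₀ (hCr i) (hr i))
    (fun i => EpsID1.persistent_prepared D Θ₀ (Cr i)) _ hr₀ fun Θ hext hr' hp => ?_
  exact ⟨.ax Θ hr'.isSequent
    (EpsID1.isAxiom_of_prepared hCr hr₀ hr' h₀ hext hd hp), trivial⟩
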